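/- **Setting.** Let $T\ge 2$, $n\ge 1$, $M\ge 0$ and $p$ be integers with $p>n+M$ and $p>n+1$, such that $t-1$ divides $M$ for all $t\in\{2,\dots,T\}$; let $\sigma\ge 0$ and $w_1^*,\dots,w_T^*\in\mathbb{R}^p$. For $t\in\{1,\dots,T\}$ let $X_{t,0}\in\mathbb{R}^{p\times n}$ and $Y_{t,0}=X_{t,0}^\top w_t^*+z_{t,0}$ be the data of task $t$, and for $1\le h\le t-1$ let $X_{t,h}\in\mathbb{R}^{p\times \frac{M}{t-1}}$ and $Y_{t,h}=X_{t,h}^\top w_h^*+z_{t,h}$ be the memory data of task $h$ at time $t$. All entries of all $X_{t,h}$ are standard Gaussian, all entries of all $z_{t,h}$ are $\mathcal N(0,\sigma^2)$, and all of them are independent. Put $w_0=0$. *Concurrent rehearsal*: $w_t$ minimizes $\|w-w_{t-1}\|^2$ subject to $X_{t,h}^\top w=Y_{t,h}$ for all $0\le h\le t-1$. *Sequential rehearsal*: $w_t^{(-1)}=w_{t-1}$, $w_t^{(h)}$ minimizes $\|w-w_t^{(h-1)}\|^2$ subject to $X_{t,h}^\top w=Y_{t,h}$ for $h=0,1,\dots,t-1$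 in turn, and $w_t=w_t^{(t-1)}$. (The constraints are feasible almost surely.) Let $\mathcal L_i(w)=\|w-w_i^*\|^2$, $$F_T=\frac1{T-1}\sum_{i=1}^{T-1}\mathbb E[\mathcal L_i(w_T)-\mathcal L_i(w_i)],\qquad G_T=\frac1T\sum_{i=1}^{T}\mathbb E[\mathcal L_i(w_T)].$$ **Proposition.** For sequential rehearsal, and for concurrent rehearsal if moreover $p>n+M+1$, the model errors are integrable, and with the coefficients below, for all $i,t\in\{1,\dots,T\}$, $$\mathbb E\,\mathcal L_i(w_t)=d_{0t}\|w_i^*\|^2+\sum_{j,k=1}^T d_{ijkt}\|w_j^*-w_k^*\|^2+\mathrm{noise}_t(\sigma),$$ $$F_T=\frac1{T-1}\Big[\sum_{i=1}^{T-1}c_i\|w_i^*\|^2+\sum_{i=1}^{T-1}\sum_{j,k=1}^{T}c_{ijk}\|w_j^*-w_k^*\|^2+\sum_{i=1}^{T-1}\big(\mathrm{noise}_T(\sigma)-\mathrm{noise}_i(\sigma)\big)\Big],$$ $$G_T=\frac1T\Big[d_{0T}\sum_{i=1}^T\|w_i^*\|^2+\sum_{i=1}^T\sum_{j,k=1}^T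 d_{ijkT}\|w_j^*-w_k^*\|^2\Big]+\mathrm{noise}_T(\sigma).$$ Here $r_a=1-\frac{n+a}{p}$; $B_{l,t}=\frac{M}{(t-l-1)p}$ if $l\ne t-1$ and $B_{t-1,t}=0$; $H_{l,t}=\frac{B_{l,t}}{p-n-M-1}$; $\Delta_t(a)=\prod_{l=0}^{a-1}\big[(1-B_{l,t})^{t-l-1}r_0\big]$; $\Lambda_{a,\sigma}=\frac{a\sigma^2}{p-a-1}$. For both methods $c_i=d_{0T}-d_{0i}$ and $c_{ijk}=d_{ijkT}-d_{ijki}$, each with the coefficients of that method. *Concurrent.* $d_{0t}=r_0r_M^{t-1}$. Let $I_{m,t}=r_M^{t-m}\,nH_{t-m,t}+\sum_{l=0}^{t-m-1}p\,r_M^l B_{l,t}H_{l,t}$ if $m\le t$ and $I_{m,t}=0$ if $m>t$. Then $$d_{ijkt}=\begin{cases}(1-r_0)r_M^{t-j}+\sum_{l=0}^{t-j-1}r_M^lB_{l,t}+I_{\max(i,j),t}& k=i,\ j\le t,\\ I_{k,t}& j<k,\ j\ne i,\ k\neq i,\\ 0&\text{otherwise,}\end{cases}$$ $$\mathrm{noise}_t(\sigma)=r_M^{t-1}\Lambda_{n,\sigma}+\sum_{l=0}^{t-2}r_M^l\Lambda_{n+M,\sigma}.$$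 *Sequential.* $d_{0t}=r_0\Delta_t(t-1)$, $$d_{ijkt}=\begin{cases}(1-r_0)(1-B_{t-j,t})^{j-1}\Delta_t(t-j)+\sum_{l=0}^{t-j-1}\Delta_t(l)(1-B_{l,t})^{t-j-l-1}B_{l,t}& k=i,\ j\le t-1,\\ (1-r_0)(1-B_{0,t})^{t-1}& k=i,\ j=t,\\ 0&\text{otherwise,}\end{cases}$$ $$\mathrm{noise}_t(\sigma)=\Delta_t(t-1)\Lambda_{n,\sigma}+\sum_{l=0}^{t-2}\Delta_t(l)\Big[(1-B_{l,t})^{t-l-1}\Lambda_{n,\sigma}+\sum_{h=1}^{t-l-1}(1-B_{l,t})^{t-l-1-h}\Lambda_{\frac{M}{t-l-1},\sigma}\Big].$$ -/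

import Mathlib

open MeasureTheory ProbabilityTheory Finset
open scoped NNReal Matrix

namespace Rehearsal

/-! ### Data model

Tasks are numbered `t = 1, 2, …`. The data used at time `t` come in blocks `(t, h)`, `0 ≤ h < t`:
block `(t, 0)` is the data set of task `t` (with `n` samples), and block `(t, h)`, `1 ≤ h < t`, is
the memory set kept at time `t` for the earlier task `h` (with `M / (t - 1)` samples). -/

/-- Number of samples in block `(t, h)`. -/
def blockSize (n M t h : ℕ) : ℕ := if h = 0 then n else M / (t - 1)

/-- The task whose ground truth generates block `(t, h)`. -/
def blockTask (t h : ℕ) : ℕ := if h = 0 then t else h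

/-- Index of one scalar entry of the data up to time `T`: a block `(t, h)`, a sample of the block,
and either a feature coordinate (`some a`) or the noise of the sample (`none`). -/
def EntryIndex (T p n M : ℕ) : Type :=
  Σ b : {b : ℕ × ℕ // 1 ≤ b.1 ∧ b.1 ≤ T ∧ b.2 < b.1},
    Fin (blockSize n M b.1.1 b.1.2) × Option (Fin p)

/-- The scalar random variable at a given entry. -/
def entry {Ω : Type*} {T p n M : ℕ}
    (X : (t h : ℕ) → Ω → Matrix (Fin p) (Fin (blockSize n M t h)) ℝ)
    (z : (t h : ℕ) → Ω → Fin (blockSize n M t h) → ℝ) : EntryIndex T p n M → Ω → ℝ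
  | ⟨b, s, some a⟩ => fun ω => X b.1.1 b.1.2 ω a s
  | ⟨b, s, none⟩ => fun ω => z b.1.1 b.1.2 ω s

/-- All feature entries up to time `T` are standard Gaussian, all noise entries are
`N(0, σ²)`, and all these scalars (current data and fresh memory data) are independent. -/
structure IsGaussianData {Ω : Type*} [MeasurableSpace Ω] (μ : Measure Ω) (T p n M : ℕ) (σ : ℝ≥0)
    (X : (t h : ℕ) → Ω → Matrix (Fin p) (Fin (blockSize n M t h)) ℝ)
    (z : (t h : ℕ) → Ω → Fin (blockSize n M t h) → ℝ) : Prop where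
  feature : ∀ t h : ℕ, 1 ≤ t → t ≤ T → h < t → ∀ a s,
    HasLaw (fun ω => X t h ω a s) (gaussianReal 0 1) μ
  noise : ∀ t h : ℕ, 1 ≤ t → t ≤ T → h < t → ∀ s,
    HasLaw (fun ω => z t h ω s) (gaussianReal 0 (σ ^ 2)) μ
  indep : iIndepFun (entry (T := T) X z) μ

/-- The parameters that fit block `(t, h)` exactly: `Xᵀ w = Y`, where `Y = Xᵀ w* + z` for the
ground truth `w*` of the task of the block. Here `X` and `z` are realizations of the data. -/
def fits {p n M : ℕ} (wstar : ℕ → EuclideanSpace ℝ (Fin p))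
    (X : (t h : ℕ) → Matrix (Fin p) (Fin (blockSize n M t h)) ℝ)
    (z : (t h : ℕ) → Fin (blockSize n M t h) → ℝ) (t h : ℕ) : Set (EuclideanSpace ℝ (Fin p)) :=
  {w | (X t h)ᵀ *ᵥ w.ofLp = (X t h)ᵀ *ᵥ (wstar (blockTask t h)).ofLp + z t h}

open Classical in
/-- The point of `S` nearest to `w₀` (`w₀` itself if there is none). -/
noncomputable def nearest {p : ℕ} (S : Set (EuclideanSpace ℝ (Fin p)))
    (w₀ : EuclideanSpace ℝ (Fin p)) : EuclideanSpace ℝ (Fin p) :=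
  if hS : ∃ w ∈ S, ∀ v ∈ S, ‖w - w₀‖ ^ 2 ≤ ‖v - w₀‖ ^ 2 then hS.choose else w₀

/-- Concurrent rehearsal: `w_0 = 0`, and `w_t` is the point nearest to `w_{t-1}` that fits the
current data and all memory sets of time `t`. -/
noncomputable def concurrent {p n M : ℕ} (wstar : ℕ → EuclideanSpace ℝ (Fin p))
    (X : (t h : ℕ) → Matrix (Fin p) (Fin (blockSize n M t h)) ℝ)
    (z : (t h : ℕ) → Fin (blockSize n M t h) → ℝ) : ℕ → EuclideanSpace ℝ (Fin p)
  | 0 => 0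
  | t + 1 => nearest {w | ∀ h < t + 1, w ∈ fits wstar X z (t + 1) h} (concurrent wstar X z t)

/-- The inner loop of sequential rehearsal at time `t`, started at `w₀`: after `m` steps the blocks
`(t, 0), …, (t, m - 1)` have been fitted one after the other. -/
noncomputable def sequentialInner {p n M : ℕ} (wstar : ℕ → EuclideanSpace ℝ (Fin p))
    (X : (t h : ℕ) → Matrix (Fin p) (Fin (blockSize n M t h)) ℝ)
    (z : (t h : ℕ) → Fin (blockSize n M t h) → ℝ) (t : ℕ) (w₀ : EuclideanSpace ℝ (Fin p)) :
    ℕ → EuclideanSpace ℝ (Fin p)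
  | 0 => w₀
  | m + 1 => nearest (fits wstar X z t m) (sequentialInner wstar X z t w₀ m)

/-- Sequential rehearsal: `w_0 = 0`, and `w_t` is obtained from `w_{t-1}` by fitting first the
current data and then the memory sets of tasks `1, …, t - 1`, one after the other. -/
noncomputable def sequential {p n M : ℕ} (wstar : ℕ → EuclideanSpace ℝ (Fin p))
    (X : (t h : ℕ) → Matrix (Fin p) (Fin (blockSize n M t h)) ℝ)
    (z : (t h : ℕ) → Fin (blockSize n M t h) → ℝ) : ℕ → EuclideanSpace ℝ (Fin p)
  | 0 => 0
  | t + 1 => sequentialInner wstar X z (t + 1) (sequential wstar X z t) (t + 1)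

/-! ### Performance metrics, for a random sequence of parameters `W t ω` -/

/-- Model error `𝓛_i(w) = ‖w - w_i*‖²`. -/
noncomputable def modelError {p : ℕ} (wstar : ℕ → EuclideanSpace ℝ (Fin p)) (i : ℕ)
    (w : EuclideanSpace ℝ (Fin p)) : ℝ := ‖w - wstar i‖ ^ 2

/-- Forgetting `F_T`. -/
noncomputable def forgetting {Ω : Type*} [MeasurableSpace Ω] (μ : Measure Ω) {p : ℕ}
    (wstar : ℕ → EuclideanSpace ℝ (Fin p)) (W : ℕ → Ω → EuclideanSpace ℝ (Fin p)) (T : ℕ) : ℝ :=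
  1 / ((T : ℝ) - 1) * ∑ i ∈ Icc 1 (T - 1),
    ∫ ω, (modelError wstar i (W T ω) - modelError wstar i (W i ω)) ∂μ

/-- Generalization error `G_T`. -/
noncomputable def genError {Ω : Type*} [MeasurableSpace Ω] (μ : Measure Ω) {p : ℕ}
    (wstar : ℕ → EuclideanSpace ℝ (Fin p)) (W : ℕ → Ω → EuclideanSpace ℝ (Fin p)) (T : ℕ) : ℝ :=
  1 / (T : ℝ) * ∑ i ∈ Icc 1 T, ∫ ω, modelError wstar i (W T ω) ∂μ

/-! ### The coefficients -/

/-- `r_a = 1 - (n + a) / p`. -/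
noncomputable def r (p n : ℕ) (a : ℝ) : ℝ := 1 - (n + a) / p

/-- `B_{l,t} = M / ((t - l - 1) p)` if `l ≠ t - 1`, and `0` otherwise. -/
noncomputable def B (p M l t : ℕ) : ℝ :=
  if l + 1 = t then 0 else (M : ℝ) / (((t : ℝ) - l - 1) * p)

/-- `H_{l,t} = B_{l,t} / (p - n - M - 1)`. -/
noncomputable def H (p n M l t : ℕ) : ℝ := B p M l t / ((p : ℝ) - n - M - 1)

/-- `Δ_t(a) = ∏_{l < a} (1 - B_{l,t}) ^ (t - l - 1) r_0`. -/
noncomputable def Delta (p n M t a : ℕ) : ℝ :=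
  ∏ l ∈ range a, ((1 - B p M l t) ^ (t - l - 1) * r p n 0)

/-- `Λ_{a,σ} = a σ² / (p - a - 1)`. -/
noncomputable def Lam (p : ℕ) (a σ : ℝ) : ℝ := a * σ ^ 2 / (p - a - 1)

/-- `d_{0t}` for concurrent rehearsal. -/
noncomputable def d0Conc (p n M t : ℕ) : ℝ := r p n 0 * r p n M ^ (t - 1)

/-- Interference of a pair of tasks `j < m` in concurrent rehearsal, as a function of the later
task `m`; it is present from time `m` on. -/
noncomputable def interference (p n M m t : ℕ) : ℝ :=
  if m ≤ t then
    r p n M ^ (t - m) * n * H p n M (t - m) t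
      + ∑ l ∈ range (t - m), p * r p n M ^ l * B p M l t * H p n M l t
  else 0

/-- `d_{ijkt}` for concurrent rehearsal. -/
noncomputable def dConc (p n M i j k t : ℕ) : ℝ :=
  if k = i ∧ j ≤ t then
    (1 - r p n 0) * r p n M ^ (t - j) + ∑ l ∈ range (t - j), r p n M ^ l * B p M l t
      + interference p n M (max i j) t
  else if j < k ∧ j ≠ i ∧ k ≠ i then interference p n M k t
  else 0

/-- `noise_t(σ)` for concurrent rehearsal. -/
noncomputable def noiseConc (p n M t : ℕ) (σ : ℝ) : ℝ :=
  r p n M ^ (t - 1) * Lam p n σ + ∑ l ∈ range (t - 1), r p n M ^ l * Lam p (n + M) σ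

/-- `c_i` for concurrent rehearsal. -/
noncomputable def cConc (p n M T i : ℕ) : ℝ := d0Conc p n M T - d0Conc p n M i

/-- `c_{ijk}` for concurrent rehearsal. -/
noncomputable def cConc₃ (p n M T i j k : ℕ) : ℝ := dConc p n M i j k T - dConc p n M i j k i

/-- `d_{0t}` for sequential rehearsal. -/
noncomputable def d0Seq (p n M t : ℕ) : ℝ := r p n 0 * Delta p n M t (t - 1)

/-- `d_{ijkt}` for sequential rehearsal. -/
noncomputable def dSeq (p n M i j k t : ℕ) : ℝ :=
  if k = i ∧ j < t then
    (1 - r p n 0) * (1 - B p M (t - j) t) ^ (j - 1) * Delta p n M t (t - j)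
      + ∑ l ∈ range (t - j), Delta p n M t l * (1 - B p M l t) ^ (t - j - l - 1) * B p M l t
  else if k = i ∧ j = t then (1 - r p n 0) * (1 - B p M 0 t) ^ (t - 1)
  else 0

/-- `noise_t(σ)` for sequential rehearsal. -/
noncomputable def noiseSeq (p n M t : ℕ) (σ : ℝ) : ℝ :=
  Delta p n M t (t - 1) * Lam p n σ
    + ∑ l ∈ range (t - 1), Delta p n M t l *
        ((1 - B p M l t) ^ (t - l - 1) * Lam p n σ
          + ∑ h ∈ Icc 1 (t - l - 1),
              (1 - B p M l t) ^ (t - l - 1 - h) * Lam p ((M : ℝ) / ((t : ℝ) - l - 1)) σ)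

/-- `c_i` for sequential rehearsal. -/
noncomputable def cSeq (p n M T i : ℕ) : ℝ := d0Seq p n M T - d0Seq p n M i

/-- `c_{ijk}` for sequential rehearsal. -/
noncomputable def cSeq₃ (p n M T i j k : ℕ) : ℝ := dSeq p n M i j k T - dSeq p n M i j k i

end Rehearsal

open Rehearsal

namespace Rehearsal

/-! ### Dual families and projections onto affine constraints -/

section Dual

variable {E ι : Type*} [NormedAddCommGroup E] [InnerProductSpace ℝ E] [Fintype ι] [DecidableEq ι]

/-! Every update, in either scheme, replaces `w` by the nearest point of an affine subspace cut out
by m fresh samples `x s`, whose measured values are `inner (x s) (v s) + z s`. Relative to any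
target `c`, the new error splits orthogonally. The part of `w - c` orthogonal to the span of the
samples survives. Inside the span, the error is the quadratic form of the inverse Gram matrix in the
residuals `inner (x s) (v s - c) + z s`. This is `norm_affineUpdate_sub_sq`, an identity valid for
each realization with independent samples.

Since the samples are Gaussian and independent of `w` and of the noise, the expectation needs only
moments weighted by the inverse Gram matrix. A diagonal entry is the inverse squared distance from
one sample to the span of the others. Conditioning on the others turns its mean into an inverse
chi-square moment, computed by writing 1/r as the integral of exp(-s r). Rotation invariance reduces
the mean of `inner (x s) u * inner (x t) v * gramInv x s t` to a multiple of `inner u v`. The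
multiple follows from the diagonal moment when s = t; when s ≠ t it follows from exchangeability and
the row identity of inverse Gram times Gram.

The outcome is `hasMean_norm_affineUpdate_sub_sq`. The old error is multiplied by 1 - m/p, each
sample adds ‖v s - c‖²/p, the noise adds mσ²/(p-m-1), and disagreement between ground truths adds an
interference term in the ‖v s - v t‖². The mean error to every target thus obeys a closed affine
recursion, as `Tracks.step` records. Sequential steps use one block with a single ground truth, so
their interference vanishes. A concurrent step uses all blocks at once, so every pair of present
tasks interferes.

It remains to solve the recursions by induction on time (`seqErr_eq`, `concErr_eq`) and to match the
asymmetric indexing of the stated coefficients (`sum_dSeq`, `sum_dConc`). Forgetting and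
generalization error then follow by linearity. -/

/-- Inverse of the Gram matrix of a family of vectors. -/
noncomputable def gramInv (x : ι → E) : Matrix ι ι ℝ := (Matrix.gram ℝ x)⁻¹

/-- The dual family of `x` in the span of `x`. -/
noncomputable def dualVec (x : ι → E) (s : ι) : E := ∑ k, gramInv x s k • x k

/-- The point nearest to `w` on which the functionals `inner (x s)` take the values `b s`. -/
noncomputable def affineUpdate (x : ι → E) (b : ι → ℝ) (w : E) : E :=
  w + ∑ s, (b s - inner ℝ (x s) w) • dualVec x s

lemma gramInv_comm (x : ι → E) (s k : ι) : gramInv x s k = gramInv x k s := by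
  have h : (gramInv x)ᵀ = gramInv x := by
    rw [gramInv, Matrix.transpose_nonsing_inv]
    congr 1
    ext i j
    simp [real_inner_comm]
  exact congrFun (congrFun h k) s

lemma gramInv_mul_gram {x : ι → E} (hx : LinearIndependent ℝ x) :
    gramInv x * Matrix.gram ℝ x = 1 :=
  Matrix.nonsing_inv_mul _ (isUnit_iff_ne_zero.2 (Matrix.det_gram_ne_zero_iff_linearIndependent.2 hx))

lemma sum_gramInv_mul_inner {x : ι → E} (hx : LinearIndependent ℝ x) (s t : ι) :
    ∑ k, gramInv x s k * inner ℝ (x k) (x t) = if s = t then 1 else 0 := by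
  have h := congrFun (congrFun (gramInv_mul_gram hx) s) t
  simpa [Matrix.mul_apply, Matrix.one_apply] using h

lemma inner_dualVec_self {x : ι → E} (hx : LinearIndependent ℝ x) (s t : ι) :
    inner ℝ (dualVec x s) (x t) = if s = t then 1 else 0 := by
  rw [← sum_gramInv_mul_inner hx s t, dualVec, sum_inner]
  simp [inner_smul_left]

lemma inner_dualVec_dualVec {x : ι → E} (hx : LinearIndependent ℝ x) (s t : ι) :
    inner ℝ (dualVec x s) (dualVec x t) = gramInv x s t := by
  conv_lhs => rw [dualVec.eq_1 x t, inner_sum]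
  simp [inner_smul_right, inner_dualVec_self hx, gramInv_comm x t s]

lemma gramInv_self_eq_norm_sq {x : ι → E} (hx : LinearIndependent ℝ x) (s : ι) :
    gramInv x s s = ‖dualVec x s‖ ^ 2 := by
  rw [← inner_dualVec_dualVec hx, real_inner_self_eq_norm_sq]

/-- Cauchy–Schwarz for the dual vectors, whose Gram matrix is the inverse Gram matrix. It reduces
integrability of off-diagonal terms to diagonal ones. -/
lemma abs_mul_mul_gramInv_le {x : ι → E} (hx : LinearIndependent ℝ x) (s t : ι) (a b : ℝ) :
    |a * b * gramInv x s t| ≤ a ^ 2 * gramInv x s s + b ^ 2 * gramInv x t t := by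
  rw [gramInv_self_eq_norm_sq hx, gramInv_self_eq_norm_sq hx, ← inner_dualVec_dualVec hx, abs_mul]
  have h := abs_real_inner_le_norm (dualVec x s) (dualVec x t)
  have h1 : |a * b| * |inner ℝ (dualVec x s) (dualVec x t)|
      ≤ (|a| * ‖dualVec x s‖) * (|b| * ‖dualVec x t‖) := by
    rw [abs_mul]
    calc _ ≤ |a| * |b| * (‖dualVec x s‖ * ‖dualVec x t‖) := by gcongr
      _ = _ := by ring
  nlinarith [sq_abs a, sq_abs b, sq_nonneg (|a| * ‖dualVec x s‖ - |b| * ‖dualVec x t‖),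
    sq_nonneg (|a| * ‖dualVec x s‖), sq_nonneg (|b| * ‖dualVec x t‖)]

lemma inner_affineUpdate {x : ι → E} (hx : LinearIndependent ℝ x) (b : ι → ℝ) (w : E) (t : ι) :
    inner ℝ (x t) (affineUpdate x b w) = b t := by
  simp [affineUpdate, inner_add_right, inner_sum, inner_smul_right,
    fun s => (real_inner_comm (dualVec x s) (x t)).trans (inner_dualVec_self hx s t)]

/-- Pythagoras: the update moves `w` within the span of `x`, while two points satisfying the same
constraints differ by a vector orthogonal to that span. Existence and uniqueness of the nearest
point both come from this. -/
lemma norm_sub_sq_of_inner_eq {x : ι → E} (hx : LinearIndependent ℝ x) {b : ι → ℝ} (w : E) {v : E}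
    (hv : ∀ s, inner ℝ (x s) v = b s) :
    ‖v - w‖ ^ 2 = ‖v - affineUpdate x b w‖ ^ 2 + ‖affineUpdate x b w - w‖ ^ 2 := by
  have horth : ∀ k, inner ℝ (v - affineUpdate x b w) (x k) = 0 := fun k => by
    rw [inner_sub_left, real_inner_comm, hv, real_inner_comm, inner_affineUpdate hx, sub_self]
  have h0 : inner ℝ (v - affineUpdate x b w) (affineUpdate x b w - w) = 0 := by
    have : affineUpdate x b w - w = ∑ s, (b s - inner ℝ (x s) w) • dualVec x s := by
      simp [affineUpdate]
    rw [this, inner_sum]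
    refine Finset.sum_eq_zero fun s _ => ?_
    rw [inner_smul_right, dualVec, inner_sum]
    simp [inner_smul_right, horth]
  have := norm_add_sq_real (v - affineUpdate x b w) (affineUpdate x b w - w)
  rw [sub_add_sub_cancel, h0] at this
  linarith

/-- No mixed term between `w - c` and the residuals of `c` survives, because the update erases the
component of `w - c` in the span of `x`. Hence `w` enters only through a projection, and the
measurements only through the last sum. -/
lemma norm_affineUpdate_sub_sq {x : ι → E} (hx : LinearIndependent ℝ x) (b : ι → ℝ) (w c : E) :
    ‖affineUpdate x b w - c‖ ^ 2 = ‖w - c‖ ^ 2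
      - ∑ s, ∑ t, inner ℝ (x s) (w - c) * inner ℝ (x t) (w - c) * gramInv x s t
      + ∑ s, ∑ t, (b s - inner ℝ (x s) c) * (b t - inner ℝ (x t) c) * gramInv x s t := by
  set d := w - c with hd
  set β : ι → ℝ := fun s => b s - inner ℝ (x s) c with hβ
  set δ : ι → ℝ := fun s => inner ℝ (x s) d with hδ
  have h1 : affineUpdate x b w - c = d + ∑ s, (β s - δ s) • dualVec x s := by
    simp only [affineUpdate, hd, hβ, hδ, inner_sub_right]
    rw [add_sub_right_comm]
    congr 2
    ext s
    congr 1
    ring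
  have h2 : inner ℝ d (∑ s, (β s - δ s) • dualVec x s)
      = ∑ s, ∑ t, (β s - δ s) * δ t * gramInv x s t := by
    rw [inner_sum]
    refine Finset.sum_congr rfl fun s _ => ?_
    rw [inner_smul_right, dualVec, inner_sum, Finset.mul_sum]
    refine Finset.sum_congr rfl fun t _ => ?_
    rw [inner_smul_right, real_inner_comm]
    ring
  have h3 : ‖∑ s, (β s - δ s) • dualVec x s‖ ^ 2
      = ∑ s, ∑ t, (β s - δ s) * (β t - δ t) * gramInv x s t := by
    rw [← real_inner_self_eq_norm_sq, sum_inner]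
    refine Finset.sum_congr rfl fun s _ => ?_
    rw [inner_sum]
    refine Finset.sum_congr rfl fun t _ => ?_
    rw [inner_smul_left, inner_smul_right, inner_dualVec_dualVec hx]
    simp only [conj_trivial]
    ring
  -- Symmetry of the inverse Gram matrix makes the mixed terms in β and δ cancel at the end.
  have h4 : ∑ s, ∑ t, β s * δ t * gramInv x s t = ∑ s, ∑ t, δ s * β t * gramInv x s t := by
    rw [Finset.sum_comm]
    refine Finset.sum_congr rfl fun s _ => Finset.sum_congr rfl fun t _ => ?_
    rw [gramInv_comm]
    ring
  rw [h1, norm_add_sq_real, h2, h3]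
  change _ = _ - ∑ s, ∑ t, δ s * δ t * gramInv x s t + ∑ s, ∑ t, β s * β t * gramInv x s t
  clear_value β δ
  simp only [sub_mul, mul_sub, Finset.sum_sub_distrib]
  linarith

/-- The diagonal of the inverse Gram matrix is the inverse squared distance to the span of the
other vectors. -/
lemma gramInv_self_eq_inv {x : ι → E} (hx : LinearIndependent ℝ x) (s : ι)
    (V : Submodule ℝ E) [V.HasOrthogonalProjection] (hV : V = Submodule.span ℝ (x '' {s}ᶜ)) :
    gramInv x s s = (‖Vᗮ.starProjection (x s)‖ ^ 2)⁻¹ := by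
  have hmem : ∀ k, k ≠ s → x k ∈ V := fun k hk => hV ▸ Submodule.subset_span ⟨k, hk, rfl⟩
  have hperp : ∀ v ∈ V, inner ℝ (dualVec x s) v = 0 := by
    intro v hv
    rw [hV] at hv
    induction hv using Submodule.span_induction with
    | mem v hv =>
      obtain ⟨k, hk, rfl⟩ := hv
      rw [inner_dualVec_self hx, if_neg (Ne.symm hk)]
    | zero => simp
    | add a b _ _ ha hb => rw [inner_add_right, ha, hb, add_zero]
    | smul a b _ hb => rw [inner_smul_right, hb, mul_zero]
  have hd : dualVec x s = Vᗮ.starProjection (dualVec x s) := by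
    symm
    rw [Submodule.starProjection_eq_self_iff, Submodule.mem_orthogonal']
    exact hperp
  -- Project the expansion of the dual vector onto the complement of `V`: every term with k ≠ s lies
  -- in `V` and disappears.
  have hd2 : dualVec x s = gramInv x s s • Vᗮ.starProjection (x s) := by
    conv_lhs => rw [hd]
    conv_lhs => rw [dualVec, map_sum]
    rw [Finset.sum_eq_single s]
    · simp
    · intro k _ hk
      rw [map_smul, Submodule.starProjection_orthogonal_apply_eq_zero (hmem k hk), smul_zero]
    · simp
  have h1 : inner ℝ (dualVec x s) (Vᗮ.starProjection (x s)) = 1 := by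
    rw [← Submodule.inner_starProjection_left_eq_right, ← hd, inner_dualVec_self hx, if_pos rfl]
  rw [hd2, inner_smul_left, real_inner_self_eq_norm_sq] at h1
  exact eq_inv_of_mul_eq_one_left (by simpa using h1)

end Dual

/-- The minimizer is unique, so the arbitrary choice inside `nearest` has no effect. -/
lemma nearest_eq_affineUpdate {p : ℕ} {ι : Type*} [Fintype ι] [DecidableEq ι]
    {x : ι → EuclideanSpace ℝ (Fin p)} (hx : LinearIndependent ℝ x) (b : ι → ℝ)
    {S : Set (EuclideanSpace ℝ (Fin p))} (hS : ∀ v, v ∈ S ↔ ∀ s, inner ℝ (x s) v = b s)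
    (w : EuclideanSpace ℝ (Fin p)) : nearest S w = affineUpdate x b w := by
  have hmem : affineUpdate x b w ∈ S := (hS _).2 (inner_affineUpdate hx b w)
  have hex : ∃ u ∈ S, ∀ v ∈ S, ‖u - w‖ ^ 2 ≤ ‖v - w‖ ^ 2 := by
    refine ⟨_, hmem, fun v hv => ?_⟩
    rw [norm_sub_sq_of_inner_eq hx w ((hS v).1 hv)]
    nlinarith [sq_nonneg ‖v - affineUpdate x b w‖]
  rw [nearest, dif_pos hex]
  have h1 := norm_sub_sq_of_inner_eq hx w ((hS _).1 hex.choose_spec.1)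
  have h2 := hex.choose_spec.2 _ hmem
  have h3 : ‖hex.choose - affineUpdate x b w‖ ^ 2 ≤ 0 := by linarith
  rw [← sub_eq_zero, ← norm_eq_zero]
  exact pow_eq_zero_iff two_ne_zero |>.1 (le_antisymm h3 (sq_nonneg _))

/-! ### Inverse moments of projections of a standard Gaussian vector -/

section GaussianMoments

open scoped ENNReal

lemma lintegral_sq_gaussianReal : ∫⁻ x, ENNReal.ofReal (x ^ 2) ∂gaussianReal 0 1 = 1 := by
  have hint : Integrable (fun x : ℝ => x ^ 2) (gaussianReal 0 1) :=
    (memLp_id_gaussianReal (μ := 0) (v := 1) 2).integrable_sq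
  rw [← ofReal_integral_eq_lintegral_ofReal hint (ae_of_all _ fun x => sq_nonneg x)]
  have h := variance_fun_id_gaussianReal (μ := 0) (v := 1)
  rw [variance_of_integral_eq_zero (by fun_prop) integral_id_gaussianReal] at h
  simp [h]

lemma lintegral_exp_neg_sq_gaussianReal {s : ℝ} (hs : 0 ≤ s) :
    ∫⁻ x, ENNReal.ofReal (Real.exp (-(s * x ^ 2))) ∂gaussianReal 0 1
      = ENNReal.ofReal ((1 + 2 * s) ^ (-(1 / 2) : ℝ)) := by
  have hint : Integrable (fun x : ℝ => Real.exp (-(s * x ^ 2))) (gaussianReal 0 1) := by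
    refine Integrable.of_bound (by fun_prop) 1 (ae_of_all _ fun x => ?_)
    rw [Real.norm_eq_abs, Real.abs_exp, Real.exp_le_one_iff]
    nlinarith [mul_nonneg hs (sq_nonneg x)]
  rw [← ofReal_integral_eq_lintegral_ofReal hint (ae_of_all _ fun x => (Real.exp_pos _).le),
    integral_gaussianReal_eq_integral_smul one_ne_zero]
  congr 1
  have : ∀ x : ℝ, gaussianPDFReal 0 1 x • Real.exp (-(s * x ^ 2))
      = (√(2 * Real.pi))⁻¹ * Real.exp (-(s + 1 / 2) * x ^ 2) := by
    intro x
    simp only [gaussianPDFReal, NNReal.coe_one, mul_one, sub_zero, smul_eq_mul]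
    rw [mul_assoc, ← Real.exp_add]
    congr 2
    ring
  simp_rw [this]
  rw [integral_const_mul, integral_gaussian, ← Real.sqrt_inv, ← Real.sqrt_mul (by positivity),
    Real.rpow_neg (by positivity), ← Real.sqrt_eq_rpow, ← Real.sqrt_inv]
  congr 1
  have := Real.pi_pos
  field_simp
  ring

/-- An explicit antiderivative, with exponent -(k/2 - 1); the condition 2 < k is what makes it
vanish at infinity. -/
lemma lintegral_Ioi_one_add_rpow {k : ℝ} (hk : 2 < k) :
    ∫⁻ s in Set.Ioi (0 : ℝ), ENNReal.ofReal ((1 + 2 * s) ^ (-(k / 2)))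
      = ENNReal.ofReal (1 / (k - 2)) := by
  have hderiv : ∀ s ∈ Set.Ici (0 : ℝ), HasDerivAt
      (fun s : ℝ => -(1 / (k - 2)) * (1 + 2 * s) ^ (-(k / 2 - 1))) ((1 + 2 * s) ^ (-(k / 2))) s := by
    intro s hs
    have hs' : (0 : ℝ) ≤ s := hs
    have h1 : HasDerivAt (fun s : ℝ => 1 + 2 * s) 2 s := by
      simpa using ((hasDerivAt_id s).const_mul 2).const_add 1
    have h2 := (h1.rpow_const (p := -(k / 2 - 1)) (Or.inl (by positivity))).const_mul (-(1 / (k - 2)))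
    have h3 : -(k / 2 - 1) - 1 = -(k / 2) := by ring
    rw [h3] at h2
    refine h2.congr_deriv ?_
    have : k - 2 ≠ 0 := by linarith
    field_simp
  have hnonneg : ∀ s ∈ Set.Ioi (0 : ℝ), 0 ≤ (1 + 2 * s) ^ (-(k / 2)) := fun s hs => by
    have : (0 : ℝ) < s := hs
    positivity
  have hlim : Filter.Tendsto (fun s : ℝ => -(1 / (k - 2)) * (1 + 2 * s) ^ (-(k / 2 - 1)))
      Filter.atTop (nhds 0) := by
    have h1 : Filter.Tendsto (fun s : ℝ => 1 + 2 * s) Filter.atTop Filter.atTop :=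
      Filter.tendsto_atTop_add_const_left _ _ (Filter.tendsto_id.const_mul_atTop two_pos)
    have h2 := ((tendsto_rpow_neg_atTop (y := k / 2 - 1) (by linarith)).comp h1).const_mul
      (-(1 / (k - 2)))
    simpa using h2
  have hI := integrableOn_Ioi_deriv_of_nonneg' hderiv hnonneg hlim
  rw [← ofReal_integral_eq_lintegral_ofReal hI
    ((ae_restrict_iff' measurableSet_Ioi).2 (ae_of_all _ hnonneg)),
    integral_Ioi_of_hasDerivAt_of_nonneg' hderiv hnonneg hlim]
  simp

/-- With extended values the identity also holds at r = 0, where both sides are infinite, so no null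
set has to be removed before it is used under an integral. -/
lemma inv_ofReal_eq_lintegral_exp {r : ℝ} (hr : 0 ≤ r) :
    (ENNReal.ofReal r)⁻¹ = ∫⁻ s in Set.Ioi (0 : ℝ), ENNReal.ofReal (Real.exp (-(s * r))) := by
  rcases hr.eq_or_lt with rfl | hr
  · simp
  · have h : ∀ s : ℝ, Real.exp (-(s * r)) = Real.exp (-r * s) := fun s => by ring_nf
    simp_rw [h]
    rw [← ofReal_integral_eq_lintegral_ofReal (integrableOn_exp_mul_Ioi (by linarith) 0)
      (ae_of_all _ fun x => (Real.exp_pos _).le), integral_exp_mul_Ioi (by linarith),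
      ← ENNReal.ofReal_inv_of_pos hr]
    congr 1
    simp

lemma lintegral_pi_prod {κ : Type*} [Fintype κ] {α : κ → Type*} [∀ i, MeasurableSpace (α i)]
    (μ : ∀ i, Measure (α i)) [∀ i, IsProbabilityMeasure (μ i)] {g : ∀ i, α i → ℝ≥0∞}
    (hg : ∀ i, Measurable (g i)) :
    ∫⁻ a, ∏ i, g i (a i) ∂Measure.pi μ = ∏ i, ∫⁻ y, g i y ∂μ i := by
  refine (lintegral_prod_eq_prod_lintegral_of_indepFun univ (fun i (a : ∀ i, α i) => g i (a i))
    (iIndepFun_pi fun i => (hg i).aemeasurable)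
    fun i => (hg i).comp (measurable_pi_apply i)).trans ?_
  refine Finset.prod_congr rfl fun i _ => ?_
  exact (measurePreserving_eval μ i).lintegral_comp (hg i)

/-- Inverse moment of a sum of squares of independent standard Gaussians, weighted by functions of
the remaining coordinates. -/
lemma lintegral_pi_mul_inv_sum_sq {κ : Type*} [Fintype κ] [DecidableEq κ] (J : Finset κ)
    (hJ : 3 ≤ #J) (h : κ → ℝ → ℝ≥0∞) (hm : ∀ i, Measurable (h i)) (h1 : ∀ i ∈ J, h i = 1)
    (hint : ∀ i, ∫⁻ y, h i y ∂gaussianReal 0 1 = 1) :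
    ∫⁻ a, (∏ i, h i (a i)) * (ENNReal.ofReal (∑ i ∈ J, a i ^ 2))⁻¹
        ∂Measure.pi (fun _ : κ => gaussianReal 0 1)
      = ENNReal.ofReal (1 / ((#J : ℝ) - 2)) := by
  have e1 : ∀ a : κ → ℝ, (∏ i, h i (a i)) * (ENNReal.ofReal (∑ i ∈ J, a i ^ 2))⁻¹
      = ∫⁻ s in Set.Ioi (0 : ℝ),
        ∏ i, h i (a i) * (if i ∈ J then ENNReal.ofReal (Real.exp (-(s * a i ^ 2))) else 1) := by
    intro a
    rw [inv_ofReal_eq_lintegral_exp (Finset.sum_nonneg fun i _ => sq_nonneg _),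
      ← lintegral_const_mul _ (by fun_prop)]
    refine lintegral_congr fun s => ?_
    rw [Finset.prod_mul_distrib, Finset.prod_ite_mem, Finset.univ_inter,
      ← ENNReal.ofReal_prod_of_nonneg fun i _ => (Real.exp_pos _).le, ← Real.exp_sum,
      Finset.mul_sum, Finset.sum_neg_distrib]
  simp_rw [e1]
  -- Tonelli. For fixed s the integrand is a product over coordinates: each coordinate in `J`
  -- contributes the Laplace transform (1 + 2s)^(-1/2), and every other one contributes 1.
  rw [lintegral_lintegral_swap]
  · have hJ' : (2 : ℝ) < #J := by exact_mod_cast hJ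
    rw [← lintegral_Ioi_one_add_rpow hJ']
    refine setLIntegral_congr_fun measurableSet_Ioi fun s hs => ?_
    have hs' : (0 : ℝ) < s := hs
    rw [lintegral_pi_prod (fun _ => gaussianReal 0 1)
      (g := fun i y => h i y * (if i ∈ J then ENNReal.ofReal (Real.exp (-(s * y ^ 2))) else 1))
      fun i => (hm i).mul (by split_ifs <;> fun_prop)]
    have e2 : ∀ i, ∫⁻ y, h i y * (if i ∈ J then ENNReal.ofReal (Real.exp (-(s * y ^ 2))) else 1)
        ∂gaussianReal 0 1 = if i ∈ J then ENNReal.ofReal ((1 + 2 * s) ^ (-(1 / 2) : ℝ)) else 1 := by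
      intro i
      split_ifs with hi
      · rw [← lintegral_exp_neg_sq_gaussianReal hs'.le]
        simp [h1 i hi]
      · simp [hint i]
    simp_rw [e2]
    rw [Finset.prod_ite_mem, Finset.univ_inter, Finset.prod_const, ← ENNReal.ofReal_pow
      (by positivity), ← Real.rpow_natCast, ← Real.rpow_mul (by positivity)]
    congr 2
    ring
  · refine Measurable.aemeasurable ?_
    refine Finset.measurable_prod _ fun i _ => ?_
    refine ((hm i).comp (by fun_prop)).mul ?_
    split_ifs <;> fun_prop

variable {E : Type*} [NormedAddCommGroup E] [InnerProductSpace ℝ E] [FiniteDimensional ℝ E]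
  [MeasurableSpace E] [BorelSpace E]

omit [MeasurableSpace E] [BorelSpace E] in
-- In such a basis a standard Gaussian vector has independent standard coordinates, and its
-- projections to `V` and to the complement use disjoint sets of them.
lemma exists_adapted_orthonormalBasis (V : Submodule ℝ E) :
    ∃ b : OrthonormalBasis (Fin (Module.finrank ℝ V) ⊕ Fin (Module.finrank ℝ Vᗮ)) ℝ E,
      (∀ i, b (Sum.inl i) ∈ V) ∧ ∀ i, b (Sum.inr i) ∈ Vᗮ := by
  set b₁ := stdOrthonormalBasis ℝ V
  set b₂ := stdOrthonormalBasis ℝ Vᗮ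
  let v : Fin (Module.finrank ℝ V) ⊕ Fin (Module.finrank ℝ Vᗮ) → E :=
    Sum.elim (fun i => (b₁ i : E)) (fun i => (b₂ i : E))
  have hv : Orthonormal ℝ v := by
    rw [orthonormal_iff_ite]
    rintro (i | i) (j | j)
    · have := orthonormal_iff_ite.1 b₁.orthonormal i j
      simpa [v] using this
    · simpa [v] using Submodule.inner_right_of_mem_orthogonal (b₁ i).2 (b₂ j).2
    · simpa [v] using Submodule.inner_left_of_mem_orthogonal (b₁ j).2 (b₂ i).2
    · have := orthonormal_iff_ite.1 b₂.orthonormal i j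
      simpa [v] using this
  have hcard : Fintype.card (Fin (Module.finrank ℝ V) ⊕ Fin (Module.finrank ℝ Vᗮ))
      = Module.finrank ℝ E := by
    simp [Submodule.finrank_add_finrank_orthogonal]
  have hsp : ⊤ ≤ Submodule.span ℝ (Set.range v) := by
    rcases isEmpty_or_nonempty (Fin (Module.finrank ℝ V) ⊕ Fin (Module.finrank ℝ Vᗮ)) with h | h
    · have : Module.finrank ℝ E = 0 := by rw [← hcard, Fintype.card_eq_zero_iff]; exact h
      have : Subsingleton E := Module.finrank_zero_iff.1 this
      intro x _
      rw [Subsingleton.elim x 0]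
      exact zero_mem _
    · exact (hv.linearIndependent.span_eq_top_of_card_eq_finrank hcard).ge
  refine ⟨OrthonormalBasis.mk hv hsp, fun i => ?_, fun i => ?_⟩ <;> simp [v]

omit [MeasurableSpace E] [BorelSpace E] in
lemma norm_sq_starProjection_of_adapted (V : Submodule ℝ E)
    {b : OrthonormalBasis (Fin (Module.finrank ℝ V) ⊕ Fin (Module.finrank ℝ Vᗮ)) ℝ E}
    (h₁ : ∀ i, b (Sum.inl i) ∈ V) (h₂ : ∀ i, b (Sum.inr i) ∈ Vᗮ)
    (a : Fin (Module.finrank ℝ V) ⊕ Fin (Module.finrank ℝ Vᗮ) → ℝ) :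
    ‖V.starProjection (∑ i, a i • b i)‖ ^ 2 = ∑ i, a (Sum.inl i) ^ 2 ∧
      ‖Vᗮ.starProjection (∑ i, a i • b i)‖ ^ 2 = ∑ i, a (Sum.inr i) ^ 2 := by
  have o := b.orthonormal
  have h₁' : ∀ i, V.starProjection (b (Sum.inl i)) = b (Sum.inl i) := fun i =>
    Submodule.starProjection_eq_self_iff.2 (h₁ i)
  have h₂' : ∀ i, Vᗮ.starProjection (b (Sum.inr i)) = b (Sum.inr i) := fun i =>
    Submodule.starProjection_eq_self_iff.2 (h₂ i)
  have h₃ : ∀ i, V.starProjection (b (Sum.inr i)) = 0 := fun i =>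
    (Submodule.starProjection_apply_eq_zero_iff _).2 (h₂ i)
  have h₄ : ∀ i, Vᗮ.starProjection (b (Sum.inl i)) = 0 := fun i =>
    Submodule.starProjection_orthogonal_apply_eq_zero (h₁ i)
  have o₁ : Orthonormal ℝ fun i => b (Sum.inl i) := o.comp _ Sum.inl_injective
  have o₂ : Orthonormal ℝ fun i => b (Sum.inr i) := o.comp _ Sum.inr_injective
  constructor
  · simp only [map_add, map_sum, map_smul, Fintype.sum_sum_type, h₁', h₃, smul_zero, Finset.sum_const_zero,
      add_zero]
    rw [← real_inner_self_eq_norm_sq, o₁.inner_sum]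
    simp [sq]
  · simp only [map_add, map_sum, map_smul, Fintype.sum_sum_type, h₂', h₄, smul_zero, Finset.sum_const_zero,
      zero_add]
    rw [← real_inner_self_eq_norm_sq, o₂.inner_sum]
    simp [sq]

lemma lintegral_stdGaussian_inv_norm_sq (V : Submodule ℝ E) (hV : 3 ≤ Module.finrank ℝ Vᗮ) :
    ∫⁻ x, (ENNReal.ofReal (‖Vᗮ.starProjection x‖ ^ 2))⁻¹ ∂stdGaussian E
      = ENNReal.ofReal (1 / ((Module.finrank ℝ Vᗮ : ℝ) - 2)) := by
  obtain ⟨b, h₁, h₂⟩ := exists_adapted_orthonormalBasis V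
  rw [stdGaussian_eq_map_pi_orthonormalBasis b, lintegral_map (by fun_prop) (by fun_prop)]
  have h := lintegral_pi_mul_inv_sum_sq
    (κ := Fin (Module.finrank ℝ V) ⊕ Fin (Module.finrank ℝ Vᗮ)) (univ.map Function.Embedding.inr)
    (by simpa using hV) 1 (fun i => measurable_const) (fun _ _ => rfl) (by simp)
  simp only [Finset.card_map, Finset.card_univ, Fintype.card_fin] at h
  rw [← h]
  refine lintegral_congr fun a => ?_
  rw [(norm_sq_starProjection_of_adapted V h₁ h₂ a).2]
  simp

lemma lintegral_stdGaussian_norm_sq_mul_inv (V : Submodule ℝ E) (hV : 3 ≤ Module.finrank ℝ Vᗮ) :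
    ∫⁻ x, ENNReal.ofReal (‖V.starProjection x‖ ^ 2)
        * (ENNReal.ofReal (‖Vᗮ.starProjection x‖ ^ 2))⁻¹ ∂stdGaussian E
      = ENNReal.ofReal (Module.finrank ℝ V / ((Module.finrank ℝ Vᗮ : ℝ) - 2)) := by
  obtain ⟨b, h₁, h₂⟩ := exists_adapted_orthonormalBasis V
  rw [stdGaussian_eq_map_pi_orthonormalBasis b, lintegral_map (by fun_prop) (by fun_prop)]
  -- One weighted inverse moment for each coordinate j along `V`: the weight is y² at j and 1
  -- elsewhere, so it has mean 1 and does not involve the denominator.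
  have h : ∀ j : Fin (Module.finrank ℝ V), _ := fun j => lintegral_pi_mul_inv_sum_sq
    (κ := Fin (Module.finrank ℝ V) ⊕ Fin (Module.finrank ℝ Vᗮ)) (univ.map Function.Embedding.inr)
    (by simpa using hV) (fun i => if i = Sum.inl j then fun y => ENNReal.ofReal (y ^ 2) else 1)
    (fun i => by split_ifs; fun_prop; exact measurable_const) (fun i hi => by
      obtain ⟨k, _, rfl⟩ := Finset.mem_map.1 hi
      simp)
    (fun i => by split_ifs; exact lintegral_sq_gaussianReal; simp)
  simp only [Finset.card_map, Finset.card_univ, Fintype.card_fin] at h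
  have hsum : ∀ a : Fin (Module.finrank ℝ V) ⊕ Fin (Module.finrank ℝ Vᗮ) → ℝ,
      ENNReal.ofReal (‖V.starProjection (∑ i, a i • b i)‖ ^ 2)
        * (ENNReal.ofReal (‖Vᗮ.starProjection (∑ i, a i • b i)‖ ^ 2))⁻¹
      = ∑ j, (∏ i, (if i = Sum.inl j then fun y => ENNReal.ofReal (y ^ 2) else 1 : ℝ → ℝ≥0∞) (a i))
        * (ENNReal.ofReal (∑ i ∈ univ.map Function.Embedding.inr, a i ^ 2))⁻¹ := by
    intro a
    rw [(norm_sq_starProjection_of_adapted V h₁ h₂ a).1,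
      (norm_sq_starProjection_of_adapted V h₁ h₂ a).2, ENNReal.ofReal_sum_of_nonneg
      (fun i _ => sq_nonneg _), Finset.sum_mul]
    refine Finset.sum_congr rfl fun j _ => ?_
    congr 1
    · rw [Finset.prod_eq_single (Sum.inl j)]
      · simp
      · intro i _ hi
        simp [hi]
      · simp
    · simp
  simp_rw [hsum]
  rw [lintegral_finsetSum]
  · simp_rw [h]
    rw [Finset.sum_const, Finset.card_univ, Fintype.card_fin, nsmul_eq_mul,
      ← ENNReal.ofReal_natCast, ← ENNReal.ofReal_mul (Nat.cast_nonneg _), mul_one_div]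
  · intro j _
    refine Measurable.mul (Finset.measurable_prod _ fun i _ => ?_) (by fun_prop)
    split_ifs
    · fun_prop
    · exact measurable_const

/-- On `V` the inverse squared distance would be infinite, yet its mean is finite. Codimension 3 is
more than the conclusion needs, but it is what the inverse moment requires. -/
lemma ae_notMem_of_three_le_finrank_orthogonal (V : Submodule ℝ E)
    (hV : 3 ≤ Module.finrank ℝ Vᗮ) : ∀ᵐ x ∂stdGaussian E, x ∉ V := by
  have h : ∀ᵐ x ∂stdGaussian E, (ENNReal.ofReal (‖Vᗮ.starProjection x‖ ^ 2))⁻¹ < ∞ := by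
    refine ae_lt_top (by fun_prop) ?_
    rw [lintegral_stdGaussian_inv_norm_sq V hV]
    exact ENNReal.ofReal_ne_top
  filter_upwards [h] with x hx hmem
  rw [Submodule.starProjection_orthogonal_apply_eq_zero hmem] at hx
  simp at hx

end GaussianMoments

/-! ### Moments of the inverse Gram matrix of independent standard Gaussian vectors -/

section Resampling

open scoped ENNReal

variable {ι : Type*} [Fintype ι] [DecidableEq ι] {α : ι → Type*} [∀ i, MeasurableSpace (α i)]
  (μ : ∀ i, Measure (α i)) [∀ i, IsProbabilityMeasure (μ i)]

/-- Resampling one coordinate preserves a product law. The integral over coordinate s no longer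
depends on that coordinate, so averaging over it again changes nothing. -/
lemma lintegral_pi_update {f : (∀ i, α i) → ℝ≥0∞} (hf : Measurable f) (s : ι) :
    ∫⁻ x, f x ∂Measure.pi μ = ∫⁻ x, ∫⁻ y, f (Function.update x s y) ∂μ s ∂Measure.pi μ := by
  have hne : Nonempty (∀ i, α i) := ⟨fun i => (nonempty_of_isProbabilityMeasure (μ i)).some⟩
  set g : (∀ i, α i) → ℝ≥0∞ := fun x => ∫⁻ y, f (Function.update x s y) ∂μ s with hg
  have hgm : Measurable g := by
    have : Measurable fun q : (∀ i, α i) × α s => f (Function.update q.1 s q.2) :=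
      hf.comp measurable_update'
    exact this.lintegral_prod_right'
  have hgs : (fun x => ∫⁻ y, g (Function.update x s y) ∂μ s) = g := by
    ext x
    simp [hg, Function.update_idem]
  rw [lintegral_eq_lmarginal_univ hne.some, lmarginal_erase' f hf (mem_univ s),
    lintegral_eq_lmarginal_univ hne.some, lmarginal_erase' g hgm (mem_univ s), hgs]

lemma ae_pi_of_ae_update {P : (∀ i, α i) → Prop} (hP : MeasurableSet {x | P x}) (s : ι)
    (h : ∀ᵐ x ∂Measure.pi μ, ∀ᵐ y ∂μ s, P (Function.update x s y)) :
    ∀ᵐ x ∂Measure.pi μ, P x := by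
  have hm : Measurable ({x | P x}ᶜ.indicator (1 : (∀ i, α i) → ℝ≥0∞)) :=
    measurable_one.indicator hP.compl
  have h0 : ∫⁻ x, {x | P x}ᶜ.indicator 1 x ∂Measure.pi μ = 0 := by
    rw [lintegral_pi_update μ hm s, ← lintegral_zero (μ := Measure.pi μ)]
    refine lintegral_congr_ae ?_
    filter_upwards [h] with x hx
    rw [← lintegral_zero (μ := μ s)]
    refine lintegral_congr_ae ?_
    filter_upwards [hx] with y hy
    simp [hy]
  rw [lintegral_indicator_one hP.compl] at h0
  exact h0

end Resampling

/-! ### Gaussian frames: independence and moments of the inverse Gram matrix. -/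

section GaussianFrame

open scoped ENNReal

variable {ι : Type*} [Fintype ι] [DecidableEq ι]
  {E : Type*} [NormedAddCommGroup E] [InnerProductSpace ℝ E] [FiniteDimensional ℝ E]
  [MeasurableSpace E] [BorelSpace E]

variable (ι E) in
/-- The law of a family of independent standard Gaussian vectors. -/
noncomputable def gaussianFrame : Measure (ι → E) := Measure.pi fun _ => stdGaussian E

instance : IsProbabilityMeasure (gaussianFrame ι E) :=
  inferInstanceAs (IsProbabilityMeasure (Measure.pi _))

omit [Fintype ι] [DecidableEq ι] [MeasurableSpace E] [BorelSpace E] [FiniteDimensional ℝ E] in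
lemma continuous_gram : Continuous fun x : ι → E => Matrix.gram ℝ x :=
  continuous_matrix fun i j => by
    simp only [Matrix.gram_apply]
    fun_prop

/-- Inverse determinant times adjugate is valid everywhere: for a singular Gram matrix both sides
are 0 by convention. -/
lemma measurable_gramInv (s t : ι) : Measurable fun x : ι → E => gramInv x s t := by
  have h : (fun x : ι → E => gramInv x s t)
      = fun x => (Matrix.gram ℝ x).det⁻¹ * (Matrix.gram ℝ x).adjugate s t := by
    ext x
    simp [gramInv, Matrix.inv_def]
  rw [h]
  exact (continuous_gram.matrix_det.measurable.inv).mul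
    (continuous_gram.matrix_adjugate.matrix_elem s t).measurable

omit [DecidableEq ι] in
lemma measurableSet_linearIndepOn (S : Finset ι) :
    MeasurableSet {x : ι → E | LinearIndepOn ℝ x (S : Set ι)} := by
  classical
  have h : {x : ι → E | LinearIndepOn ℝ x (S : Set ι)}
      = {x | (Matrix.gram ℝ fun i : S => x i).det ≠ 0} := by
    ext x
    exact (Matrix.det_gram_ne_zero_iff_linearIndependent (𝕜 := ℝ)).symm
  rw [h]
  have hc : Continuous fun x : ι → E => (Matrix.gram ℝ fun i : S => x i).det :=
    (continuous_gram.comp (by fun_prop : Continuous fun (x : ι → E) (i : S) => x i)).matrix_det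
  exact hc.measurable (measurableSet_singleton 0).compl

omit [Fintype ι] [FiniteDimensional ℝ E] [MeasurableSpace E] [BorelSpace E] in
lemma linearIndepOn_insert_update {x : ι → E} {S : Set ι} {s : ι} (hs : s ∉ S) {y : E}
    (hx : LinearIndepOn ℝ x S) (hy : y ∉ Submodule.span ℝ (x '' S)) :
    LinearIndepOn ℝ (Function.update x s y) (insert s S) := by
  have himg : ∀ i ∈ S, Function.update x s y i = x i := fun i hi =>
    Function.update_of_ne (ne_of_mem_of_not_mem hi hs) _ _
  rw [linearIndepOn_insert hs, Set.image_congr himg, Function.update_self]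
  exact ⟨hx.congr fun i hi => (himg i hi).symm, hy⟩

omit [DecidableEq ι] [MeasurableSpace E] [BorelSpace E] in
-- At most m - 1 vectors span the subspace, so its codimension is at least p - m + 1. This is where
-- p > m + 1 becomes the condition for finite inverse moments.
lemma three_le_finrank_orthogonal_span {x : ι → E} {S : Finset ι} {s : ι} (hs : s ∉ S)
    (hι : Fintype.card ι + 1 < Module.finrank ℝ E) :
    3 ≤ Module.finrank ℝ (Submodule.span ℝ (x '' (S : Set ι)))ᗮ := by
  classical
  have h1 := Submodule.finrank_add_finrank_orthogonal (Submodule.span ℝ (x '' (S : Set ι)))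
  have h2 : Module.finrank ℝ (Submodule.span ℝ (x '' (S : Set ι))) ≤ #S := by
    rw [← Finset.coe_image]
    exact (finrank_span_finset_le_card _).trans Finset.card_image_le
  have h3 : #S < Fintype.card ι := Finset.card_lt_univ_of_notMem hs
  omega

/-- Add the vectors one at a time: a fresh Gaussian vector almost surely avoids the span of those
already present. -/
lemma ae_linearIndepOn (hι : Fintype.card ι + 1 < Module.finrank ℝ E) (S : Finset ι) :
    ∀ᵐ x ∂gaussianFrame ι E, LinearIndepOn ℝ x (S : Set ι) := by
  induction S using Finset.induction_on with
  | empty => simp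
  | insert s S hs ih =>
    refine ae_pi_of_ae_update _ (measurableSet_linearIndepOn _) s ?_
    filter_upwards [ih] with x hx
    filter_upwards [ae_notMem_of_three_le_finrank_orthogonal _
      (three_le_finrank_orthogonal_span (x := x) hs hι)] with y hy
    rw [Finset.coe_insert]
    exact linearIndepOn_insert_update (by simpa using hs) hx hy

lemma ae_linearIndependent (hι : Fintype.card ι + 1 < Module.finrank ℝ E) :
    ∀ᵐ x ∂gaussianFrame ι E, LinearIndependent ℝ x := by
  filter_upwards [ae_linearIndepOn hι univ] with x hx
  rwa [Finset.coe_univ, linearIndepOn_univ_iff] at hx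

/-- Condition on all vectors except `x s`. Almost surely they span a subspace of dimension m - 1,
and the diagonal entry is the inverse squared distance of `x s` to it. The inner integral is then
the same constant for every such subspace. -/
lemma lintegral_comp_norm_sq_mul_gramInv_self (hι : Fintype.card ι + 1 < Module.finrank ℝ E)
    (s : ι) {φ : E → ℝ} (hφ : Measurable φ) (hφ0 : ∀ y, 0 ≤ φ y) {c : ℝ≥0∞}
    (hc : ∀ V : Submodule ℝ E, Module.finrank ℝ V + 1 = Fintype.card ι →
      ∫⁻ y, ENNReal.ofReal (φ y) * (ENNReal.ofReal (‖Vᗮ.starProjection y‖ ^ 2))⁻¹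
        ∂stdGaussian E = c) :
    ∫⁻ x, ENNReal.ofReal (φ (x s) * gramInv x s s) ∂gaussianFrame ι E = c := by
  have hm : Measurable fun x : ι → E => ENNReal.ofReal (φ (x s) * gramInv x s s) :=
    ((hφ.comp (measurable_pi_apply s)).mul (measurable_gramInv s s)).ennreal_ofReal
  rw [gaussianFrame, lintegral_pi_update _ hm s]
  have hconst : ∫⁻ _, c ∂Measure.pi (fun _ : ι => stdGaussian E) = c := by simp
  rw [← hconst]
  refine lintegral_congr_ae ?_
  have hae : ∀ᵐ x ∂Measure.pi (fun _ : ι => stdGaussian E), _ := ae_linearIndepOn hι ({s}ᶜ)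
  filter_upwards [hae] with x hx
  rw [← hc (Submodule.span ℝ (x '' (({s}ᶜ : Finset ι) : Set ι)))]
  · refine lintegral_congr_ae ?_
    filter_upwards [ae_notMem_of_three_le_finrank_orthogonal _
      (three_le_finrank_orthogonal_span (x := x) (s := s) (S := {s}ᶜ) (by simp) hι)] with y hy
    have hli : LinearIndependent ℝ (Function.update x s y) := by
      have h := linearIndepOn_insert_update (s := s) (by simp) hx hy
      rw [← Finset.coe_insert, Finset.insert_compl_self, Finset.coe_univ, linearIndepOn_univ_iff] at h
      exact h
    have himg : Function.update x s y '' {s}ᶜ = x '' (({s}ᶜ : Finset ι) : Set ι) := by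
      rw [Finset.coe_compl, Finset.coe_singleton]
      exact Set.image_congr fun i hi => Function.update_of_ne hi _ _
    rw [gramInv_self_eq_inv hli s _ (by rw [himg]), Function.update_self,
      ENNReal.ofReal_mul (hφ0 y), ENNReal.ofReal_inv_of_pos]
    refine pow_pos (norm_pos_iff.2 fun h0 => hy ?_) 2
    rw [Submodule.starProjection_apply_eq_zero_iff, Submodule.orthogonal_orthogonal] at h0
    exact h0
  · have h1 : Module.finrank ℝ (Submodule.span ℝ (x '' (({s}ᶜ : Finset ι) : Set ι)))
        = Fintype.card (({s}ᶜ : Finset ι) : Set ι) := by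
      have := finrank_span_eq_card hx
      rwa [← Set.image_eq_range] at this
    rw [h1]
    have := Fintype.card_pos_iff.2 ⟨s⟩
    have h2 : Fintype.card (({s}ᶜ : Finset ι) : Set ι) = #({s}ᶜ : Finset ι) := Fintype.card_coe _
    rw [h2, Finset.card_compl, Finset.card_singleton]
    omega

lemma lintegral_gramInv_self (hι : Fintype.card ι + 1 < Module.finrank ℝ E) (s : ι) :
    ∫⁻ x, ENNReal.ofReal (gramInv x s s) ∂gaussianFrame ι E
      = ENNReal.ofReal (1 / (Module.finrank ℝ E - Fintype.card ι - 1)) := by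
  have h := lintegral_comp_norm_sq_mul_gramInv_self hι s (φ := fun _ => 1)
    (c := ENNReal.ofReal (1 / (Module.finrank ℝ E - Fintype.card ι - 1))) measurable_const
    (fun _ => zero_le_one) (fun V hV => by
      have h1 := Submodule.finrank_add_finrank_orthogonal V
      have h2 : (Module.finrank ℝ Vᗮ : ℝ) - 2 = Module.finrank ℝ E - Fintype.card ι - 1 := by
        rw [← h1, ← hV]
        push_cast
        ring
      simp only [ENNReal.ofReal_one, one_mul]
      rw [lintegral_stdGaussian_inv_norm_sq V (by omega), h2])
  simpa using h

/-- Splitting ‖y‖² along `V` and its complement, the ratio to the squared distance is 1 plus a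
quotient of independent sums of squares, so its mean is 1 + (m-1)/(p-m-1). -/
lemma lintegral_norm_sq_mul_gramInv_self (hι : Fintype.card ι + 1 < Module.finrank ℝ E) (s : ι) :
    ∫⁻ x, ENNReal.ofReal (‖x s‖ ^ 2 * gramInv x s s) ∂gaussianFrame ι E
      = ENNReal.ofReal ((Module.finrank ℝ E - 2) / (Module.finrank ℝ E - Fintype.card ι - 1)) := by
  refine lintegral_comp_norm_sq_mul_gramInv_self hι s (φ := fun y => ‖y‖ ^ 2)
    (by fun_prop) (fun _ => sq_nonneg _) (fun V hV => ?_)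
  have h1 := Submodule.finrank_add_finrank_orthogonal V
  have h3 : 3 ≤ Module.finrank ℝ Vᗮ := by omega
  have h2 : (Module.finrank ℝ Vᗮ : ℝ) - 2 = Module.finrank ℝ E - Fintype.card ι - 1 := by
    rw [← h1, ← hV]
    push_cast
    ring
  have hpos : (0 : ℝ) < Module.finrank ℝ Vᗮ - 2 := by
    have : (3 : ℝ) ≤ Module.finrank ℝ Vᗮ := by exact_mod_cast h3
    linarith
  have hval : ((Module.finrank ℝ E : ℝ) - 2) / (Module.finrank ℝ E - Fintype.card ι - 1)
      = 1 + Module.finrank ℝ V / ((Module.finrank ℝ Vᗮ : ℝ) - 2) := by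
    rw [← h2, ← h1]
    field_simp
    push_cast
    ring
  rw [hval, ENNReal.ofReal_add zero_le_one (by positivity), ENNReal.ofReal_one,
    ← lintegral_stdGaussian_norm_sq_mul_inv V h3]
  have hone : (1 : ℝ≥0∞) = ∫⁻ _, 1 ∂stdGaussian E := by simp
  conv_rhs => rw [hone]
  rw [← lintegral_add_left measurable_const]
  refine lintegral_congr_ae ?_
  filter_upwards [ae_notMem_of_three_le_finrank_orthogonal V h3] with y hy
  have hne : ‖Vᗮ.starProjection y‖ ≠ 0 := by
    refine norm_ne_zero_iff.2 fun h0 => hy ?_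
    rw [Submodule.starProjection_apply_eq_zero_iff, Submodule.orthogonal_orthogonal] at h0
    exact h0
  rw [V.norm_sq_eq_add_norm_sq_starProjection y, ENNReal.ofReal_add (sq_nonneg _) (sq_nonneg _),
    add_mul, ENNReal.mul_inv_cancel (by positivity) ENNReal.ofReal_ne_top, add_comm]

/-! ### Integrability of expressions weighted by the inverse Gram matrix. -/

lemma ae_gramInv_self_nonneg (hι : Fintype.card ι + 1 < Module.finrank ℝ E) (s : ι) :
    ∀ᵐ x ∂gaussianFrame ι E, 0 ≤ gramInv x s s := by
  filter_upwards [ae_linearIndependent hι] with x hx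
  rw [gramInv_self_eq_norm_sq hx]
  positivity

lemma integrable_gramInv_self (hι : Fintype.card ι + 1 < Module.finrank ℝ E) (s : ι) :
    Integrable (fun x : ι → E => gramInv x s s) (gaussianFrame ι E) := by
  refine (lintegral_ofReal_ne_top_iff_integrable (measurable_gramInv s s).aestronglyMeasurable
    (ae_gramInv_self_nonneg hι s)).1 ?_
  rw [lintegral_gramInv_self hι]
  exact ENNReal.ofReal_ne_top

lemma integral_gramInv_self (hι : Fintype.card ι + 1 < Module.finrank ℝ E) (s : ι) :
    ∫ x, gramInv x s s ∂gaussianFrame ι E = 1 / (Module.finrank ℝ E - Fintype.card ι - 1) := by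
  have hι' : (Fintype.card ι : ℝ) + 1 < Module.finrank ℝ E := by exact_mod_cast hι
  rw [integral_eq_lintegral_of_nonneg_ae (ae_gramInv_self_nonneg hι s)
    (measurable_gramInv s s).aestronglyMeasurable, lintegral_gramInv_self hι,
    ENNReal.toReal_ofReal (one_div_nonneg.2 (by linarith))]

lemma measurable_norm_sq_mul_gramInv (s : ι) :
    Measurable fun x : ι → E => ‖x s‖ ^ 2 * gramInv x s s :=
  ((measurable_pi_apply s).norm.pow_const 2).mul (measurable_gramInv s s)

lemma ae_norm_sq_mul_gramInv_nonneg (hι : Fintype.card ι + 1 < Module.finrank ℝ E) (s : ι) :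
    0 ≤ᵐ[gaussianFrame ι E] fun x : ι → E => ‖x s‖ ^ 2 * gramInv x s s := by
  filter_upwards [ae_gramInv_self_nonneg hι s] with x hx
  exact mul_nonneg (sq_nonneg _) hx

lemma integrable_norm_sq_mul_gramInv_self (hι : Fintype.card ι + 1 < Module.finrank ℝ E) (s : ι) :
    Integrable (fun x : ι → E => ‖x s‖ ^ 2 * gramInv x s s) (gaussianFrame ι E) := by
  refine (lintegral_ofReal_ne_top_iff_integrable
    (measurable_norm_sq_mul_gramInv s).aestronglyMeasurable
    (ae_norm_sq_mul_gramInv_nonneg hι s)).1 ?_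
  rw [lintegral_norm_sq_mul_gramInv_self hι]
  exact ENNReal.ofReal_ne_top

lemma integral_norm_sq_mul_gramInv_self (hι : Fintype.card ι + 1 < Module.finrank ℝ E) (s : ι) :
    ∫ x, ‖x s‖ ^ 2 * gramInv x s s ∂gaussianFrame ι E
      = (Module.finrank ℝ E - 2) / (Module.finrank ℝ E - Fintype.card ι - 1) := by
  have hι' : (Fintype.card ι : ℝ) + 1 < Module.finrank ℝ E := by exact_mod_cast hι
  have h1 : (1 : ℝ) ≤ Fintype.card ι := by exact_mod_cast Fintype.card_pos_iff.2 ⟨s⟩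
  rw [integral_eq_lintegral_of_nonneg_ae (ae_norm_sq_mul_gramInv_nonneg hι s)
    (measurable_norm_sq_mul_gramInv s).aestronglyMeasurable, lintegral_norm_sq_mul_gramInv_self hι,
    ENNReal.toReal_ofReal (div_nonneg (by linarith) (by linarith))]

lemma integrable_mul_mul_gramInv (hι : Fintype.card ι + 1 < Module.finrank ℝ E) (s t : ι)
    {f g : (ι → E) → ℝ} (hf : Measurable f) (hg : Measurable g)
    (hfi : Integrable (fun x => f x ^ 2 * gramInv x s s) (gaussianFrame ι E))
    (hgi : Integrable (fun x => g x ^ 2 * gramInv x t t) (gaussianFrame ι E)) :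
    Integrable (fun x => f x * g x * gramInv x s t) (gaussianFrame ι E) := by
  refine (hfi.add hgi).mono' ((hf.mul hg).mul (measurable_gramInv s t)).aestronglyMeasurable ?_
  filter_upwards [ae_linearIndependent hι] with x hx
  exact abs_mul_mul_gramInv_le hx s t _ _

lemma integrable_inner_sq_mul_gramInv (hι : Fintype.card ι + 1 < Module.finrank ℝ E) (s : ι)
    (u : E) : Integrable (fun x => (inner ℝ (x s) u) ^ 2 * gramInv x s s) (gaussianFrame ι E) := by
  refine ((integrable_norm_sq_mul_gramInv_self hι s).mul_const (‖u‖ ^ 2)).mono'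
    (Measurable.aestronglyMeasurable (Measurable.mul (by fun_prop) (measurable_gramInv s s))) ?_
  filter_upwards [ae_gramInv_self_nonneg hι s] with x hx
  rw [Real.norm_eq_abs, abs_mul, abs_of_nonneg hx, abs_of_nonneg (sq_nonneg _)]
  have h1 : (inner ℝ (x s) u) ^ 2 ≤ (‖x s‖ * ‖u‖) ^ 2 :=
    sq_le_sq.2 (by rw [abs_of_nonneg (a := ‖x s‖ * ‖u‖) (by positivity)]
                   exact abs_real_inner_le_norm _ _)
  calc _ ≤ (‖x s‖ * ‖u‖) ^ 2 * gramInv x s s := by gcongr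
    _ = _ := by ring

lemma integrable_inner_mul_inner_mul_gramInv (hι : Fintype.card ι + 1 < Module.finrank ℝ E)
    (s t : ι) (u v : E) : Integrable (fun x => inner ℝ (x s) u * inner ℝ (x t) v * gramInv x s t)
      (gaussianFrame ι E) :=
  integrable_mul_mul_gramInv hι s t (by fun_prop) (by fun_prop)
    (integrable_inner_sq_mul_gramInv hι s u) (integrable_inner_sq_mul_gramInv hι t v)

lemma integrable_inner_mul_gramInv (hι : Fintype.card ι + 1 < Module.finrank ℝ E)
    (s t : ι) (u : E) : Integrable (fun x => inner ℝ (x s) u * gramInv x s t)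
      (gaussianFrame ι E) := by
  have := integrable_mul_mul_gramInv hι s t (f := fun x => inner ℝ (x s) u) (g := fun _ => 1)
    (by fun_prop) measurable_const (integrable_inner_sq_mul_gramInv hι s u)
    (by simpa using integrable_gramInv_self hι t)
  simpa using this

lemma integrable_gramInv (hι : Fintype.card ι + 1 < Module.finrank ℝ E)
    (s t : ι) : Integrable (fun x => gramInv x s t) (gaussianFrame ι E) := by
  have := integrable_mul_mul_gramInv hι s t (f := fun _ => 1) (g := fun _ => 1)
    measurable_const measurable_const (by simpa using integrable_gramInv_self hι s)
    (by simpa using integrable_gramInv_self hι t)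
  simpa using this

/-! #### Symmetries -/

omit [DecidableEq ι] in
lemma measurePreserving_isometry (O : E ≃ₗᵢ[ℝ] E) :
    MeasurePreserving (fun (x : ι → E) i => O (x i)) (gaussianFrame ι E) (gaussianFrame ι E) :=
  measurePreserving_pi _ _ fun _ => ⟨O.continuous.measurable, stdGaussian_map O⟩

omit [DecidableEq ι] in
lemma measurePreserving_perm (e : Equiv.Perm ι) :
    MeasurePreserving (fun (x : ι → E) i => x (e i)) (gaussianFrame ι E) (gaussianFrame ι E) := by
  refine ⟨by fun_prop, (Measure.pi_eq fun S hS => ?_).symm⟩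
  rw [Measure.map_apply (by fun_prop) (MeasurableSet.univ_pi hS)]
  have : (fun (x : ι → E) i => x (e i)) ⁻¹' (Set.univ.pi S) = Set.univ.pi fun i => S (e.symm i) := by
    ext x
    simp only [Set.mem_preimage, Set.mem_pi, Set.mem_univ, true_implies]
    exact ⟨fun h i => by simpa using h (e.symm i), fun h i => by simpa using h (e i)⟩
  rw [this, gaussianFrame, Measure.pi_pi]
  exact Equiv.prod_comp e.symm fun i => stdGaussian E (S i)

omit [FiniteDimensional ℝ E] [MeasurableSpace E] [BorelSpace E] in
lemma gramInv_isometry (O : E ≃ₗᵢ[ℝ] E) (x : ι → E) : gramInv (fun i => O (x i)) = gramInv x := by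
  rw [gramInv, gramInv]
  congr 1
  ext i j
  simp

omit [FiniteDimensional ℝ E] [MeasurableSpace E] [BorelSpace E] in
lemma gramInv_perm (e : Equiv.Perm ι) (x : ι → E) (s t : ι) :
    gramInv (fun i => x (e i)) s t = gramInv x (e s) (e t) := by
  have h : Matrix.gram ℝ (fun i => x (e i)) = (Matrix.gram ℝ x).submatrix e e := rfl
  rw [gramInv, h, Matrix.inv_submatrix_equiv]
  rfl

/-- Rotating the whole frame changes neither its law nor its Gram matrix. -/
lemma integral_isometry (O : E ≃ₗᵢ[ℝ] E) (s t : ι) (u v : E) :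
    ∫ x, inner ℝ (x s) (O u) * inner ℝ (x t) (O v) * gramInv x s t ∂gaussianFrame ι E
      = ∫ x, inner ℝ (x s) u * inner ℝ (x t) v * gramInv x s t ∂gaussianFrame ι E := by
  have hm : Measurable fun x : ι → E => inner ℝ (x s) (O u) * inner ℝ (x t) (O v) * gramInv x s t :=
    Measurable.mul (by fun_prop) (measurable_gramInv s t)
  conv_lhs => rw [← (measurePreserving_isometry O).map_eq, integral_map
    (measurePreserving_isometry O).measurable.aemeasurable hm.aestronglyMeasurable]
  simp only [gramInv_isometry, LinearIsometryEquiv.inner_map_map]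

lemma integrable_inner_mul_gramInv_pair (hι : Fintype.card ι + 1 < Module.finrank ℝ E) (s t : ι) :
    Integrable (fun x => inner ℝ (x s) (x t) * gramInv x s t) (gaussianFrame ι E) := by
  have b := stdOrthonormalBasis ℝ E
  have h : ∀ x : ι → E, inner ℝ (x s) (x t) * gramInv x s t
      = ∑ a, inner ℝ (x s) (b a) * inner ℝ (x t) (b a) * gramInv x s t := fun x => by
    rw [← b.sum_inner_mul_inner, Finset.sum_mul]
    simp_rw [real_inner_comm (x t)]
  simp_rw [h]
  exact integrable_finsetSum _ fun a _ => integrable_inner_mul_inner_mul_gramInv hι s t _ _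

/-- As a function of u and v the left side is a rotation-invariant bilinear form, hence a multiple
of the inner product. Its trace over an orthonormal basis determines the multiple. -/
lemma integral_inner_mul_inner_mul_gramInv_eq_inner_mul
    (hι : Fintype.card ι + 1 < Module.finrank ℝ E) (s t : ι) (u v : E) :
    ∫ x, inner ℝ (x s) u * inner ℝ (x t) v * gramInv x s t ∂gaussianFrame ι E
      = inner ℝ u v / Module.finrank ℝ E *
        ∫ x, inner ℝ (x s) (x t) * gramInv x s t ∂gaussianFrame ι E := by
  have b := stdOrthonormalBasis ℝ E
  set A : E → E → ℝ := fun u v =>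
    ∫ x, inner ℝ (x s) u * inner ℝ (x t) v * gramInv x s t ∂gaussianFrame ι E with hA
  have hoff : ∀ a c, a ≠ c → A (b a) (b c) = 0 := by
    intro a c hac
    -- This reflection negates `b a` and fixes `b c`, so the off-diagonal value equals its own
    -- negative.
    have h := integral_isometry (Submodule.reflection (ℝ ∙ b a)ᗮ) s t (b a) (b c)
    have hc : b c ∈ (ℝ ∙ b a)ᗮ := by
      rw [Submodule.mem_orthogonal_singleton_iff_inner_right]
      exact b.orthonormal.2 hac
    rw [Submodule.reflection_orthogonalComplement_singleton_eq_neg,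
      Submodule.reflection_mem_subspace_eq_self hc] at h
    simp only [inner_neg_right, neg_mul, integral_neg] at h
    change -A (b a) (b c) = A (b a) (b c) at h
    linarith
  have hdiag : ∀ a c, A (b a) (b a) = A (b c) (b c) := by
    intro a c
    -- This reflection sends `b a` to `b c`, which makes the diagonal values equal.
    have h := integral_isometry (Submodule.reflection (ℝ ∙ (b a - b c))ᗮ) s t (b a) (b a)
    rw [Submodule.reflection_sub (by simp)] at h
    exact h.symm
  have hsum : ∫ x, inner ℝ (x s) (x t) * gramInv x s t ∂gaussianFrame ι E
      = ∑ a, A (b a) (b a) := by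
    rw [hA, ← integral_finsetSum _ fun a _ => integrable_inner_mul_inner_mul_gramInv hι s t _ _]
    congr 1
    ext x
    rw [← b.sum_inner_mul_inner, Finset.sum_mul]
    simp_rw [real_inner_comm (x t)]
  have hexp : A u v = ∑ a, ∑ c, inner ℝ (b a) u * inner ℝ (b c) v * A (b a) (b c) := by
    simp only [hA]
    have : ∀ x : ι → E, inner ℝ (x s) u * inner ℝ (x t) v * gramInv x s t
        = ∑ a, ∑ c, inner ℝ (b a) u * inner ℝ (b c) v *
          (inner ℝ (x s) (b a) * inner ℝ (x t) (b c) * gramInv x s t) := fun x => by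
      rw [← b.sum_inner_mul_inner (x s) u, ← b.sum_inner_mul_inner (x t) v, Finset.sum_mul_sum,
        Finset.sum_mul]
      refine Finset.sum_congr rfl fun a _ => ?_
      rw [Finset.sum_mul]
      exact Finset.sum_congr rfl fun c _ => by ring
    simp_rw [this]
    rw [integral_finsetSum _ fun a _ => integrable_finsetSum _ fun c _ =>
      (integrable_inner_mul_inner_mul_gramInv hι s t _ _).const_mul _]
    refine Finset.sum_congr rfl fun a _ => ?_
    rw [integral_finsetSum _ fun c _ =>
      (integrable_inner_mul_inner_mul_gramInv hι s t _ _).const_mul _]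
    exact Finset.sum_congr rfl fun c _ => integral_const_mul _ _
  change A u v = _
  rw [hexp, hsum]
  have h1 : ∀ a, ∑ c, inner ℝ (b a) u * inner ℝ (b c) v * A (b a) (b c)
      = inner ℝ u (b a) * inner ℝ (b a) v * A (b a) (b a) := fun a => by
    rw [Finset.sum_eq_single a, real_inner_comm]
    · intro c _ hc
      rw [hoff a c hc.symm, mul_zero]
    · simp
  have hp : (Module.finrank ℝ E : ℝ) ≠ 0 := by
    have : 0 < Module.finrank ℝ E := by omega
    positivity
  have a₀ : Fin (Module.finrank ℝ E) := ⟨0, by omega⟩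
  simp_rw [h1, fun a => hdiag a a₀]
  rw [← Finset.sum_mul, b.sum_inner_mul_inner, Finset.sum_const, Finset.card_univ, Fintype.card_fin,
    nsmul_eq_mul]
  field_simp

/-- Exchangeability gives all off-diagonal entries of row s the same mean. The row of inverse Gram
times Gram sums to 1, and the diagonal mean is known, so m - 1 equal terms add up to 1 -
(p-2)/(p-m-1). -/
lemma integral_inner_mul_gramInv_of_ne (hι : Fintype.card ι + 1 < Module.finrank ℝ E) {s t : ι}
    (hst : s ≠ t) :
    ∫ x, inner ℝ (x s) (x t) * gramInv x s t ∂gaussianFrame ι E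
      = -1 / (Module.finrank ℝ E - Fintype.card ι - 1) := by
  have hsymm : ∀ t', s ≠ t' → ∫ x, inner ℝ (x s) (x t') * gramInv x s t' ∂gaussianFrame ι E
      = ∫ x, inner ℝ (x s) (x t) * gramInv x s t ∂gaussianFrame ι E := by
    intro t' ht'
    set e := Equiv.swap t t'
    have hm : Measurable fun x : ι → E => inner ℝ (x s) (x t) * gramInv x s t :=
      Measurable.mul (by fun_prop) (measurable_gramInv s t)
    conv_rhs => rw [← (measurePreserving_perm e).map_eq, integral_map
      (measurePreserving_perm e).measurable.aemeasurable hm.aestronglyMeasurable]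
    simp [gramInv_perm, e, Equiv.swap_apply_of_ne_of_ne hst ht']
  have hsum : ∑ t', ∫ x, inner ℝ (x s) (x t') * gramInv x s t' ∂gaussianFrame ι E = 1 := by
    rw [← integral_finsetSum _ fun t' _ => integrable_inner_mul_gramInv_pair hι s t']
    have h1 : ∫ _, (1 : ℝ) ∂gaussianFrame ι E = 1 := by simp
    rw [← h1]
    refine integral_congr_ae ?_
    filter_upwards [ae_linearIndependent hι] with x hx
    have := sum_gramInv_mul_inner hx s s
    rw [if_pos rfl] at this
    rw [← this]
    exact Finset.sum_congr rfl fun k _ => by rw [real_inner_comm, mul_comm]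
  have hself : ∫ x, inner ℝ (x s) (x s) * gramInv x s s ∂gaussianFrame ι E
      = (Module.finrank ℝ E - 2) / (Module.finrank ℝ E - Fintype.card ι - 1) := by
    simp_rw [real_inner_self_eq_norm_sq]
    exact integral_norm_sq_mul_gramInv_self hι s
  rw [← Finset.add_sum_erase _ _ (mem_univ s), hself, Finset.sum_congr rfl fun t' ht' =>
    hsymm t' (Finset.ne_of_mem_erase ht').symm, Finset.sum_const, Finset.card_erase_of_mem
    (mem_univ s), Finset.card_univ, nsmul_eq_mul] at hsum
  have hcard : 1 < Fintype.card ι := Fintype.one_lt_card_iff.2 ⟨s, t, hst⟩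
  rw [Nat.cast_sub hcard.le] at hsum
  have hcard' : (1 : ℝ) < Fintype.card ι := by exact_mod_cast hcard
  have hι' : (Fintype.card ι : ℝ) + 1 < Module.finrank ℝ E := by exact_mod_cast hι
  have hD : (Module.finrank ℝ E : ℝ) - Fintype.card ι - 1 ≠ 0 := by linarith
  have hN : (Fintype.card ι : ℝ) - 1 ≠ 0 := by linarith
  refine mul_left_cancel₀ hN ?_
  push_cast at hsum
  rw [eq_sub_of_add_eq' hsum]
  field_simp
  ring

/-- Second moments of a Gaussian frame weighted by the inverse of its Gram matrix. -/
lemma integral_inner_mul_inner_mul_gramInv (hι : Fintype.card ι + 1 < Module.finrank ℝ E)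
    (s t : ι) (u v : E) :
    ∫ x, inner ℝ (x s) u * inner ℝ (x t) v * gramInv x s t ∂gaussianFrame ι E
      = inner ℝ u v * (((if s = t then (Module.finrank ℝ E : ℝ) - 1 else 0) - 1) /
        (Module.finrank ℝ E * (Module.finrank ℝ E - Fintype.card ι - 1))) := by
  rw [integral_inner_mul_inner_mul_gramInv_eq_inner_mul hι]
  split_ifs with hst
  · subst hst
    simp_rw [real_inner_self_eq_norm_sq]
    rw [integral_norm_sq_mul_gramInv_self hι, div_mul_div_comm, mul_div_assoc]
    ring
  · rw [integral_inner_mul_gramInv_of_ne hι hst, div_mul_div_comm, mul_div_assoc]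
    ring

end GaussianFrame

/-! ### Expected effect of one update on the model error -/

section HasMean

variable {Ω : Type*} [MeasurableSpace Ω] {μ : Measure Ω}

/-- `f` is integrable with integral `m`. -/
def HasMean (μ : Measure Ω) (f : Ω → ℝ) (m : ℝ) : Prop := Integrable f μ ∧ ∫ ω, f ω ∂μ = m

namespace HasMean

variable {f g : Ω → ℝ} {a b : ℝ}

lemma add (hf : HasMean μ f a) (hg : HasMean μ g b) : HasMean μ (fun ω => f ω + g ω) (a + b) :=
  ⟨hf.1.add hg.1, by rw [integral_add hf.1 hg.1, hf.2, hg.2]⟩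

lemma sub (hf : HasMean μ f a) (hg : HasMean μ g b) : HasMean μ (fun ω => f ω - g ω) (a - b) :=
  ⟨hf.1.sub hg.1, by rw [integral_sub hf.1 hg.1, hf.2, hg.2]⟩

lemma sum {κ : Type*} (s : Finset κ) {F : κ → Ω → ℝ} {m : κ → ℝ}
    (h : ∀ i ∈ s, HasMean μ (F i) (m i)) : HasMean μ (fun ω => ∑ i ∈ s, F i ω) (∑ i ∈ s, m i) :=
  ⟨integrable_finsetSum _ fun i hi => (h i hi).1, by
    rw [integral_finsetSum _ fun i hi => (h i hi).1]
    exact Finset.sum_congr rfl fun i hi => (h i hi).2⟩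

lemma mul_of_indepFun (hfg : IndepFun f g μ) (hf : HasMean μ f a) (hg : HasMean μ g b) :
    HasMean μ (fun ω => f ω * g ω) (a * b) :=
  ⟨hfg.integrable_mul hf.1 hg.1, by
    rw [hfg.integral_fun_mul_eq_mul_integral hf.1.aestronglyMeasurable hg.1.aestronglyMeasurable,
      hf.2, hg.2]⟩

lemma congr (hf : HasMean μ f a) (hfg : g =ᵐ[μ] f) : HasMean μ g a :=
  ⟨hf.1.congr hfg.symm, by rw [integral_congr_ae hfg, hf.2]⟩

lemma eq_of_eq (hf : HasMean μ f a) (hab : a = b) : HasMean μ f b := hab ▸ hf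

lemma const [IsProbabilityMeasure μ] (a : ℝ) : HasMean μ (fun _ => a) a :=
  ⟨integrable_const a, by simp⟩

lemma comp_of_map_eq {α : Type*} [MeasurableSpace α] {ν : Measure α} {x : Ω → α}
    (hx : Measurable x) (hmap : μ.map x = ν) {φ : α → ℝ} (hφ : Integrable φ ν) :
    HasMean μ (fun ω => φ (x ω)) (∫ y, φ y ∂ν) := by
  subst hmap
  exact ⟨hφ.comp_measurable hx, (integral_map hx.aemeasurable hφ.aestronglyMeasurable).symm⟩

end HasMean

end HasMean

section Step

variable {Ω : Type*} [MeasurableSpace Ω] {μ : Measure Ω} {ι : Type*} [Fintype ι] [DecidableEq ι]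
  {E : Type*} [NormedAddCommGroup E] [InnerProductSpace ℝ E] [FiniteDimensional ℝ E]
  [MeasurableSpace E] [BorelSpace E]

lemma sum_ite_sub_one (p : ℝ) (f : ι → ι → ℝ) (q : ℝ) :
    ∑ s, ∑ t, f s t * (((if s = t then p else 0) - 1) / q)
      = (p * ∑ s, f s s - ∑ s, ∑ t, f s t) / q := by
  have : ∀ s t, f s t * (((if s = t then p else 0) - 1) / q)
      = ((if s = t then p * f s t else 0) - f s t) / q := fun s t => by
    split_ifs <;> ring
  simp_rw [this, ← Finset.sum_div, Finset.sum_sub_distrib, Finset.sum_ite_eq, Finset.mem_univ,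
    if_true, Finset.mul_sum]

omit [FiniteDimensional ℝ E] [MeasurableSpace E] [BorelSpace E] [DecidableEq ι] in
lemma sum_sum_norm_sub_sq (u : ι → E) :
    ∑ s, ∑ t, ‖u s - u t‖ ^ 2
      = 2 * Fintype.card ι * ∑ s, ‖u s‖ ^ 2 - 2 * ∑ s, ∑ t, inner ℝ (u s) (u t) := by
  simp_rw [norm_sub_sq_real, Finset.sum_add_distrib, Finset.sum_sub_distrib, Finset.sum_const,
    Finset.card_univ, nsmul_eq_mul, ← Finset.mul_sum]
  ring

/-- Expected squared norm of the projection of an independent vector on the span of a Gaussian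
frame. -/
lemma hasMean_sum_inner_mul_inner_mul_gramInv (hι : Fintype.card ι + 1 < Module.finrank ℝ E)
    {x : Ω → ι → E} (hxm : Measurable x) (hx : μ.map x = gaussianFrame ι E)
    {d : Ω → E} (hdm : Measurable d) (hdx : IndepFun d x μ) {e : ℝ}
    (hd : HasMean μ (fun ω => ‖d ω‖ ^ 2) e) :
    HasMean μ (fun ω => ∑ s, ∑ t, inner ℝ (x ω s) (d ω) * inner ℝ (x ω t) (d ω)
      * gramInv (x ω) s t) (Fintype.card ι / Module.finrank ℝ E * e) := by
  have b := stdOrthonormalBasis ℝ E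
  set m := fun a c => ∫ ω, inner ℝ (b a) (d ω) * inner ℝ (b c) (d ω) ∂μ with hm
  have hmd : ∀ a c, HasMean μ (fun ω => inner ℝ (b a) (d ω) * inner ℝ (b c) (d ω)) (m a c) := by
    refine fun a c => ⟨hd.1.mono' (Measurable.aestronglyMeasurable (by fun_prop))
      (ae_of_all _ fun ω => ?_), rfl⟩
    rw [Real.norm_eq_abs, abs_mul, sq]
    have hb : ∀ a, |inner ℝ (b a) (d ω)| ≤ ‖d ω‖ := fun a => by
      simpa using abs_real_inner_le_norm (b a) (d ω)
    gcongr <;> exact hb _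
  -- In coordinates each summand is a function of `d` times a function of the frame, so independence
  -- factors its mean. The frame factor later removes all terms with a ≠ c.
  have hterm : ∀ s t a c, HasMean μ (fun ω => inner ℝ (b a) (d ω) * inner ℝ (b c) (d ω) *
      (inner ℝ (x ω s) (b a) * inner ℝ (x ω t) (b c) * gramInv (x ω) s t)) _ := fun s t a c =>
    HasMean.mul_of_indepFun
      (hdx.comp (φ := fun y => inner ℝ (b a) y * inner ℝ (b c) y)
        (ψ := fun y => inner ℝ (y s) (b a) * inner ℝ (y t) (b c) * gramInv y s t)
        (by fun_prop) (Measurable.mul (by fun_prop) (measurable_gramInv s t)))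
      (hmd a c) (.comp_of_map_eq hxm hx (integrable_inner_mul_inner_mul_gramInv hι s t _ _))
  have hsum := HasMean.sum univ fun s _ => HasMean.sum univ fun t _ => HasMean.sum univ fun a _ =>
    HasMean.sum univ fun c _ => hterm s t a c
  refine (hsum.congr (ae_of_all _ fun ω => ?_)).eq_of_eq ?_
  · refine Finset.sum_congr rfl fun s _ => Finset.sum_congr rfl fun t _ => ?_
    rw [← b.sum_inner_mul_inner (x ω s) (d ω), ← b.sum_inner_mul_inner (x ω t) (d ω),
      Finset.sum_mul_sum, Finset.sum_mul]
    refine Finset.sum_congr rfl fun a _ => ?_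
    rw [Finset.sum_mul]
    exact Finset.sum_congr rfl fun c _ => by ring
  · have he : ∑ a, m a a = e := by
      have h1 := HasMean.sum univ fun a _ => hmd a a
      rw [← hd.2, ← h1.2]
      congr 1
      ext ω
      beta_reduce
      rw [← real_inner_self_eq_norm_sq, ← b.sum_inner_mul_inner]
      simp_rw [real_inner_comm (d ω)]
    simp_rw [integral_inner_mul_inner_mul_gramInv hι, orthonormal_iff_ite.1 b.orthonormal, ite_mul,
      one_mul, zero_mul, mul_ite, mul_zero, Finset.sum_ite_eq, Finset.mem_univ, if_true,
      ← Finset.sum_mul, he]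
    -- What remains is e times ((p-1)m - m²)/(p(p-m-1)); the factor p - m - 1 cancels and leaves
    -- m/p.
    rw [sum_ite_sub_one]
    have hι' : (Fintype.card ι : ℝ) + 1 < Module.finrank ℝ E := by exact_mod_cast hι
    have hp : (0 : ℝ) < Module.finrank ℝ E := by linarith [(Nat.cast_nonneg _ : (0:ℝ) ≤ Fintype.card ι)]
    have hD : (Module.finrank ℝ E : ℝ) - Fintype.card ι - 1 ≠ 0 := by linarith
    simp only [Finset.sum_const, Finset.card_univ, nsmul_eq_mul]
    field_simp
    ring

/-- Expected error of the minimum-change interpolator of noisy linear measurements taken along a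
Gaussian frame, where the measured vector may depend on the measurement. -/
theorem hasMean_norm_affineUpdate_sub_sq [IsProbabilityMeasure μ]
    (hι : Fintype.card ι + 1 < Module.finrank ℝ E)
    {x : Ω → ι → E} (hxm : Measurable x) (hx : μ.map x = gaussianFrame ι E)
    {w : Ω → E} (hwm : Measurable w) (hwx : IndepFun w x μ)
    {z : Ω → ι → ℝ} (hzx : IndepFun z x μ) {σ : ℝ}
    (hz1 : ∀ s, HasMean μ (fun ω => z ω s) 0)
    (hz2 : ∀ s t, HasMean μ (fun ω => z ω s * z ω t) (if s = t then σ ^ 2 else 0))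
    (v : ι → E) (c : E) {e : ℝ} (he : HasMean μ (fun ω => ‖w ω - c‖ ^ 2) e) :
    HasMean μ (fun ω =>
        ‖affineUpdate (x ω) (fun s => inner ℝ (x ω s) (v s) + z ω s) (w ω) - c‖ ^ 2)
      ((1 - Fintype.card ι / Module.finrank ℝ E) * e
        + (∑ s, ‖v s - c‖ ^ 2) / Module.finrank ℝ E
        + (∑ s, ∑ t, ‖v s - v t‖ ^ 2)
          / (2 * Module.finrank ℝ E * (Module.finrank ℝ E - Fintype.card ι - 1))
        + Fintype.card ι * σ ^ 2 / (Module.finrank ℝ E - Fintype.card ι - 1)) := by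
  set u := fun s => v s - c with hu
  have hproj := hasMean_sum_inner_mul_inner_mul_gramInv hι hxm hx (d := fun ω => w ω - c)
    (by fun_prop) (hwx.comp (φ := fun y => y - c) (ψ := id) (by fun_prop) measurable_id) he
  have hgm := fun s t => measurable_gramInv (ι := ι) (E := E) s t
  have h1 : ∀ s t, HasMean μ (fun ω => inner ℝ (x ω s) (u s) * inner ℝ (x ω t) (u t)
      * gramInv (x ω) s t) _ := fun s t =>
    .comp_of_map_eq hxm hx (integrable_inner_mul_inner_mul_gramInv hι s t _ _)
  have h2 : ∀ s t r, HasMean μ (fun ω => z ω r * (inner ℝ (x ω s) (u s) * gramInv (x ω) s t)) _ :=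
    fun s t r => HasMean.mul_of_indepFun
      (hzx.comp (φ := fun y : ι → ℝ => y r) (ψ := fun y => inner ℝ (y s) (u s) * gramInv y s t)
        (by fun_prop) (Measurable.mul (by fun_prop) (hgm s t)))
      (hz1 r) (.comp_of_map_eq hxm hx (integrable_inner_mul_gramInv hι s t _))
  have h3 : ∀ s t, HasMean μ (fun ω => z ω s * z ω t * gramInv (x ω) s t) _ :=
    fun s t => HasMean.mul_of_indepFun
      (hzx.comp (φ := fun y : ι → ℝ => y s * y t) (ψ := fun y => gramInv y s t)
        (by fun_prop) (hgm s t))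
      (hz2 s t) (.comp_of_map_eq hxm hx (integrable_gramInv hι s t))
  -- The product of the residuals at s and t, expanded. The two terms linear in the noise have mean
  -- zero, because the noise is centered and independent of the frame.
  have hfit := HasMean.sum univ fun s _ => HasMean.sum univ fun t _ =>
    (((h1 s t).add (h2 s t t)).add (h2 t s s)).add (h3 s t)
  refine (((he.sub hproj).add hfit).congr ?_).eq_of_eq ?_
  · have hli : ∀ᵐ ω ∂μ, LinearIndependent ℝ (x ω) := by
      have := ae_linearIndependent (ι := ι) hι
      rw [← hx] at this
      exact ae_of_ae_map hxm.aemeasurable this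
    filter_upwards [hli] with ω hω
    rw [norm_affineUpdate_sub_sq hω]
    congr 1
    refine Finset.sum_congr rfl fun s _ => Finset.sum_congr rfl fun t _ => ?_
    rw [gramInv_comm (x ω) t s]
    simp only [hu, inner_sub_right]
    ring
  · have hι' : (Fintype.card ι : ℝ) + 1 < Module.finrank ℝ E := by exact_mod_cast hι
    have hp : (0 : ℝ) < Module.finrank ℝ E := by
      linarith [(Nat.cast_nonneg _ : (0 : ℝ) ≤ Fintype.card ι)]
    have hD : (Module.finrank ℝ E : ℝ) - Fintype.card ι - 1 ≠ 0 := by linarith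
    have hvu : ∀ s t, v s - v t = u s - u t := fun s t => by simp [hu]
    simp_rw [hvu]
    -- Trading the inner products of the u s for squared differences separates the plain term Σ‖u
    -- s‖²/p from the interference, which does not depend on `c`.
    rw [sum_sum_norm_sub_sq]
    simp_rw [zero_mul, add_zero, ite_mul, zero_mul, Finset.sum_add_distrib, Finset.sum_ite_eq,
      Finset.mem_univ, if_true, integral_gramInv_self hι, integral_inner_mul_inner_mul_gramInv hι,
      sum_ite_sub_one, real_inner_self_eq_norm_sq, Finset.sum_const, Finset.card_univ,
      nsmul_eq_mul]
    field_simp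
    ring

end Step

/-! ### Sequences of updates with fresh Gaussian data -/

section Generated

variable {Ω K : Type*}

/-- The σ-algebra generated by the variables with index in `S`. -/
@[reducible]
def generatedBy (ξ : K → Ω → ℝ) (S : Set K) : MeasurableSpace Ω :=
  ⨆ e ∈ S, MeasurableSpace.comap (ξ e) inferInstance

lemma generatedBy_mono (ξ : K → Ω → ℝ) {S S' : Set K} (h : S ⊆ S') :
    generatedBy ξ S ≤ generatedBy ξ S' := biSup_mono h

lemma measurable_generatedBy (ξ : K → Ω → ℝ) {S : Set K} {e : K} (he : e ∈ S) :
    Measurable[generatedBy ξ S] (ξ e) :=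
  measurable_iff_comap_le.2
    (le_biSup (fun e => MeasurableSpace.comap (ξ e) inferInstance) he)

variable [mΩ : MeasurableSpace Ω] {μ : Measure Ω}

lemma generatedBy_le {ξ : K → Ω → ℝ} (hξ : ∀ e, Measurable (ξ e)) (S : Set K) :
    generatedBy ξ S ≤ mΩ := iSup₂_le fun e _ => (hξ e).comap_le

lemma indepFun_of_generatedBy_disjoint {ξ : K → Ω → ℝ} (hξ : ∀ e, Measurable (ξ e))
    (hi : iIndepFun ξ μ) {S S' : Set K} (hd : Disjoint S S') {α β : Type*} [MeasurableSpace α]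
    [MeasurableSpace β] {f : Ω → α} {g : Ω → β} (hf : Measurable[generatedBy ξ S] f)
    (hg : Measurable[generatedBy ξ S'] g) : IndepFun f g μ := by
  rw [IndepFun_iff_Indep]
  exact indep_of_indep_of_le (indep_iSup_of_disjoint (fun e => (hξ e).comap_le) hi.iIndep hd)
    hf.comap_le hg.comap_le

end Generated

/-! ### Gaussian samples and the evolution of the mean error under one fit. -/

section Columns

lemma measurable_affineUpdate {ι E : Type*} [Fintype ι] [DecidableEq ι] [NormedAddCommGroup E]
    [InnerProductSpace ℝ E] [FiniteDimensional ℝ E] [MeasurableSpace E] [BorelSpace E] :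
    Measurable fun q : (ι → E) × (ι → ℝ) × E => affineUpdate q.1 q.2.1 q.2.2 := by
  have hg : ∀ s t, Measurable fun q : (ι → E) × (ι → ℝ) × E => gramInv q.1 s t := fun s t =>
    (measurable_gramInv s t).comp measurable_fst
  have hd : ∀ s, Measurable fun q : (ι → E) × (ι → ℝ) × E => dualVec q.1 s := fun s =>
    Finset.measurable_sum _ fun k _ => (hg s k).smul (by fun_prop)
  exact (measurable_snd.comp measurable_snd).add
    (Finset.measurable_sum _ fun s _ => Measurable.smul (by fun_prop) (hd s))

variable {Ω : Type*} [mΩ : MeasurableSpace Ω] {μ : Measure Ω} {C : Type*} {p : ℕ} {σ : ℝ≥0}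

/-- Independent Gaussian data columns: `ξ (c, some a)` are the features and `ξ (c, none)` is the
noise of the sample `c`. -/
structure IsGaussianColumns (μ : Measure Ω) (σ : ℝ≥0) (ξ : C × Option (Fin p) → Ω → ℝ) :
    Prop where
  measurable : ∀ e, Measurable (ξ e)
  feature : ∀ c a, HasLaw (ξ (c, some a)) (gaussianReal 0 1) μ
  noise : ∀ c, HasLaw (ξ (c, none)) (gaussianReal 0 (σ ^ 2)) μ
  indep : iIndepFun ξ μ

/-- The feature vector of a sample. -/
def featureVec (ξ : C × Option (Fin p) → Ω → ℝ) (c : C) (ω : Ω) : EuclideanSpace ℝ (Fin p) :=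
  WithLp.toLp 2 fun a => ξ (c, some a) ω

omit mΩ in
lemma measurable_featureVec_generatedBy (ξ : C × Option (Fin p) → Ω → ℝ)
    {S : Set (C × Option (Fin p))} {c : C} (hc : ∀ a, (c, some a) ∈ S) :
    Measurable[generatedBy ξ S] (featureVec ξ c) := by
  have h : Measurable[generatedBy ξ S] fun ω a => ξ (c, some a) ω :=
    @measurable_pi_lambda _ _ _ (generatedBy ξ S) _ _ fun a => measurable_generatedBy ξ (hc a)
  exact (WithLp.measurable_toLp 2 (Fin p → ℝ)).comp h

variable {ξ : C × Option (Fin p) → Ω → ℝ} {ι : Type*} [Fintype ι]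

/-- Independence of the scalars over pairs (sample, coordinate) is curried into a product of product
measures, whose inner factors are standard Gaussian vectors. -/
lemma IsGaussianColumns.map_featureVec [IsProbabilityMeasure μ] (hξ : IsGaussianColumns μ σ ξ)
    {c : ι → C} (hc : Function.Injective c) :
    μ.map (fun ω i => featureVec ξ (c i) ω) = gaussianFrame ι (EuclideanSpace ℝ (Fin p)) := by
  have hinj : Function.Injective fun q : (_ : ι) × Fin p => (c q.1, some q.2) := by
    rintro ⟨i, a⟩ ⟨j, b⟩ h
    simp only [Prod.mk.injEq, Option.some.injEq] at h
    obtain ⟨h1, rfl⟩ := h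
    rw [hc h1]
  have h1 := ((hξ.indep.precomp hinj).hasLaw_pi
    fun (q : (_ : ι) × Fin p) => hξ.feature (c q.1) q.2).map_eq
  rw [← Measure.infinitePi_eq_pi] at h1
  have h2 : μ.map (fun ω i a => ξ (c i, some a) ω)
      = Measure.pi fun _ : ι => Measure.pi fun _ : Fin p => gaussianReal 0 1 := by
    have h3 := Measure.infinitePi_map_piCurry (fun (_ : ι) (_ : Fin p) => gaussianReal 0 1)
    rw [← h1, Measure.map_map (by fun_prop) (measurable_pi_lambda _ fun q => hξ.measurable _)] at h3
    simp_rw [Measure.infinitePi_eq_pi] at h3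
    exact h3
  have h4 : (fun ω i => featureVec ξ (c i) ω)
      = (fun (y : ι → Fin p → ℝ) i => (WithLp.toLp 2 (y i) : EuclideanSpace ℝ (Fin p)))
        ∘ fun ω i a => ξ (c i, some a) ω := rfl
  rw [h4, ← Measure.map_map (by fun_prop) (measurable_pi_lambda _ fun i =>
    measurable_pi_lambda _ fun a => hξ.measurable _), h2, Measure.pi_map_pi (by fun_prop)]
  simp_rw [map_pi_eq_stdGaussian]
  rfl

lemma IsGaussianColumns.hasMean_noise (hξ : IsGaussianColumns μ σ ξ) (c : C) :
    HasMean μ (ξ (c, none)) 0 := by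
  have h := HasMean.comp_of_map_eq (hξ.measurable (c, none)) (hξ.noise c).map_eq (φ := id)
    ((memLp_id_gaussianReal (μ := 0) (v := σ ^ 2) 1).integrable (by simp))
  simpa using h

omit [Fintype ι] in
lemma IsGaussianColumns.hasMean_noise_mul (hξ : IsGaussianColumns μ σ ξ) {c : ι → C}
    [DecidableEq ι] (hc : Function.Injective c) (s t : ι) :
    HasMean μ (fun ω => ξ (c s, none) ω * ξ (c t, none) ω)
      (if s = t then (σ : ℝ) ^ 2 else 0) := by
  split_ifs with hst
  · subst hst
    have h := HasMean.comp_of_map_eq (hξ.measurable (c s, none)) (hξ.noise (c s)).map_eq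
      (φ := fun y => y ^ 2) (memLp_id_gaussianReal (μ := 0) (v := σ ^ 2) 2).integrable_sq
    have hv := variance_fun_id_gaussianReal (μ := 0) (v := σ ^ 2)
    rw [variance_of_integral_eq_zero (by fun_prop) integral_id_gaussianReal] at hv
    rw [hv] at h
    simpa [sq] using h
  · have hne : (c s, (none : Option (Fin p))) ≠ (c t, none) := fun h =>
      hst (hc (Prod.mk.inj h).1)
    simpa using HasMean.mul_of_indepFun (hξ.indep.indepFun hne)
      (hξ.hasMean_noise (c s)) (hξ.hasMean_noise (c t))

/-- `W` is almost surely a function of the samples in `B`, and `e c` is the mean of its squared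
distance to `c`. -/
def Tracks (μ : Measure Ω) (ξ : C × Option (Fin p) → Ω → ℝ) (B : Set C)
    (W : Ω → EuclideanSpace ℝ (Fin p)) (e : EuclideanSpace ℝ (Fin p) → ℝ) : Prop :=
  ∃ W' : Ω → EuclideanSpace ℝ (Fin p), Measurable[generatedBy ξ (B ×ˢ Set.univ)] W' ∧
    W =ᵐ[μ] W' ∧ ∀ c, HasMean μ (fun ω => ‖W' ω - c‖ ^ 2) (e c)

lemma Tracks.hasMean {B : Set C} {W : Ω → EuclideanSpace ℝ (Fin p)}
    {e : EuclideanSpace ℝ (Fin p) → ℝ} (h : Tracks μ ξ B W e) (c : EuclideanSpace ℝ (Fin p)) :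
    HasMean μ (fun ω => ‖W ω - c‖ ^ 2) (e c) := by
  obtain ⟨W', _, h2, h3⟩ := h
  refine (h3 c).congr ?_
  filter_upwards [h2] with ω hω
  rw [hω]

lemma Tracks.mono {B B' : Set C} (hB : B ⊆ B') {W : Ω → EuclideanSpace ℝ (Fin p)}
    {e : EuclideanSpace ℝ (Fin p) → ℝ} (h : Tracks μ ξ B W e) : Tracks μ ξ B' W e := by
  obtain ⟨W', h1, h2, h3⟩ := h
  exact ⟨W', h1.mono (generatedBy_mono ξ (Set.prod_mono hB subset_rfl)) le_rfl, h2, h3⟩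

lemma tracks_zero [IsProbabilityMeasure μ] (B : Set C) :
    Tracks μ ξ B (fun _ => 0) fun c => ‖c‖ ^ 2 :=
  ⟨fun _ => 0, measurable_const, Filter.EventuallyEq.rfl, fun c => by
    simpa using HasMean.const (μ := μ) (‖c‖ ^ 2)⟩

/-- Fitting fresh samples `c i` with ground truths `v i` by the smallest possible change. -/
theorem Tracks.step [IsProbabilityMeasure μ] (hξ : IsGaussianColumns μ σ ξ) {B B' : Set C}
    {W W₁ : Ω → EuclideanSpace ℝ (Fin p)} {e : EuclideanSpace ℝ (Fin p) → ℝ}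
    (h : Tracks μ ξ B W e) {c : ι → C} (hc : Function.Injective c) (hcB : ∀ i, c i ∉ B)
    (hBB' : B ⊆ B') (hcB' : ∀ i, c i ∈ B') (hι : Fintype.card ι + 1 < p)
    (v : ι → EuclideanSpace ℝ (Fin p))
    (hW : ∀ᵐ ω ∂μ, ∃ S : Set (EuclideanSpace ℝ (Fin p)),
      (∀ u, u ∈ S ↔ ∀ i, inner ℝ (featureVec ξ (c i) ω) u
        = inner ℝ (featureVec ξ (c i) ω) (v i) + ξ (c i, none) ω) ∧ W₁ ω = nearest S (W ω)) :
    Tracks μ ξ B' W₁ fun u =>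
      (1 - Fintype.card ι / p) * e u + (∑ s, ‖v s - u‖ ^ 2) / p
        + (∑ s, ∑ t, ‖v s - v t‖ ^ 2) / (2 * p * (p - Fintype.card ι - 1))
        + Fintype.card ι * (σ : ℝ) ^ 2 / (p - Fintype.card ι - 1) := by
  classical
  obtain ⟨W', h1, h2, h3⟩ := h
  have hfin : Module.finrank ℝ (EuclideanSpace ℝ (Fin p)) = p := by simp
  have hι' : Fintype.card ι + 1 < Module.finrank ℝ (EuclideanSpace ℝ (Fin p)) := by rwa [hfin]
  set x : Ω → ι → EuclideanSpace ℝ (Fin p) := fun ω i => featureVec ξ (c i) ω with hxdef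
  set zz : Ω → ι → ℝ := fun ω i => ξ (c i, none) ω with hzdef
  have hmapx := hξ.map_featureVec hc
  have hxgen : ∀ S : Set (C × Option (Fin p)), (∀ i a, (c i, some a) ∈ S) →
      Measurable[generatedBy ξ S] x := fun S hS =>
    @measurable_pi_lambda _ _ _ (generatedBy ξ S) _ _ fun i =>
      measurable_featureVec_generatedBy ξ (hS i)
  have hzgen : ∀ S : Set (C × Option (Fin p)), (∀ i, (c i, none) ∈ S) →
      Measurable[generatedBy ξ S] zz := fun S hS =>
    @measurable_pi_lambda _ _ _ (generatedBy ξ S) _ _ fun i => measurable_generatedBy ξ (hS i)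
  have hxm : Measurable x := (hxgen Set.univ (by simp)).mono (generatedBy_le hξ.measurable _) le_rfl
  have hwm : Measurable W' := h1.mono (generatedBy_le hξ.measurable _) le_rfl
  have hwx : IndepFun W' x μ := by
    refine indepFun_of_generatedBy_disjoint hξ.measurable hξ.indep (S' := Set.range c ×ˢ Set.univ)
      ?_ h1 (hxgen _ (by simp))
    rw [Set.disjoint_left]
    rintro ⟨c', o⟩ ⟨hB, _⟩ ⟨⟨i, rfl⟩, _⟩
    exact hcB i hB
  -- Noise and features may come from the same samples; they are separated by the second index,
  -- `none` against `some`.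
  have hzx : IndepFun zz x μ := by
    refine indepFun_of_generatedBy_disjoint hξ.measurable hξ.indep (S := Set.univ ×ˢ {none})
      (S' := Set.univ ×ˢ (Set.range some)) ?_ (hzgen _ (by simp)) (hxgen _ (by simp))
    rw [Set.disjoint_left]
    rintro ⟨c', o⟩ ⟨_, ho⟩ ⟨_, a, rfl⟩
    simp at ho
  have hB'gen : generatedBy ξ (B ×ˢ (Set.univ : Set (Option (Fin p))))
      ≤ generatedBy ξ (B' ×ˢ Set.univ) := generatedBy_mono ξ (Set.prod_mono hBB' subset_rfl)
  have hx' : Measurable[generatedBy ξ (B' ×ˢ Set.univ)] x := hxgen _ fun i _ => ⟨hcB' i, trivial⟩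
  have hz' : Measurable[generatedBy ξ (B' ×ˢ Set.univ)] zz := hzgen _ fun i => ⟨hcB' i, trivial⟩
  have hw' : Measurable[generatedBy ξ (B' ×ˢ Set.univ)] W' := h1.mono hB'gen le_rfl
  -- The explicit update serves as the measurable version: `nearest`, defined by choice, agrees with
  -- it whenever the samples are linearly independent, hence almost surely.
  refine ⟨fun ω => affineUpdate (x ω) (fun s => inner ℝ (x ω s) (v s) + zz ω s) (W' ω), ?_, ?_, ?_⟩
  · have hm : Measurable fun q : (ι → EuclideanSpace ℝ (Fin p)) × (ι → ℝ)
        × EuclideanSpace ℝ (Fin p) =>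
        affineUpdate q.1 (fun s => inner ℝ (q.1 s) (v s) + q.2.1 s) q.2.2 :=
      measurable_affineUpdate.comp (f := fun q : (ι → EuclideanSpace ℝ (Fin p)) × (ι → ℝ)
        × EuclideanSpace ℝ (Fin p) => (q.1, fun s => inner ℝ (q.1 s) (v s) + q.2.1 s, q.2.2))
        (by fun_prop)
    exact hm.comp (hx'.prodMk (hz'.prodMk hw'))
  · have hli : ∀ᵐ ω ∂μ, LinearIndependent ℝ (x ω) := by
      have := ae_linearIndependent (ι := ι) hι'
      rw [← hmapx] at this
      exact ae_of_ae_map hxm.aemeasurable this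
    filter_upwards [h2, hW, hli] with ω hω1 hω2 hω3
    obtain ⟨S, hS1, hS2⟩ := hω2
    rw [hS2, hω1]
    exact nearest_eq_affineUpdate hω3 _ hS1 _
  · intro u
    have := hasMean_norm_affineUpdate_sub_sq hι' hxm hmapx hwm hwx hzx
      (fun s => hξ.hasMean_noise (c s)) (fun s t => hξ.hasMean_noise_mul hc s t) v u (h3 u)
    rwa [hfin] at this

end Columns

/-! ### Mean errors of the two rehearsal schemes as recursions -/

section Schemes

/-- Indices of the data blocks up to time `T`. -/
abbrev BlockIndex (T : ℕ) : Type := {b : ℕ × ℕ // 1 ≤ b.1 ∧ b.1 ≤ T ∧ b.2 < b.1}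

/-- Indices of the samples up to time `T`. -/
abbrev SampleIndex (T n M : ℕ) : Type := Σ b : BlockIndex T, Fin (blockSize n M b.1.1 b.1.2)

/-- The samples of a set of blocks. -/
def samplesOf (T n M : ℕ) (𝓑 : Set (ℕ × ℕ)) : Set (SampleIndex T n M) := {c | c.1.1 ∈ 𝓑}

lemma samplesOf_mono {T n M : ℕ} {𝓑 𝓑' : Set (ℕ × ℕ)} (h : 𝓑 ⊆ 𝓑') :
    samplesOf T n M 𝓑 ⊆ samplesOf T n M 𝓑' := fun _ hc => h hc

variable {Ω : Type*} [MeasurableSpace Ω] {μ : Measure Ω} {T p n M : ℕ} {σ : ℝ≥0}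
  {X : (t h : ℕ) → Ω → Matrix (Fin p) (Fin (blockSize n M t h)) ℝ}
  {z : (t h : ℕ) → Ω → Fin (blockSize n M t h) → ℝ}

/-- The variables `ξ` are almost surely the entries of the data `X`, `z`. -/
def AgreesWith (μ : Measure Ω) (X : (t h : ℕ) → Ω → Matrix (Fin p) (Fin (blockSize n M t h)) ℝ)
    (z : (t h : ℕ) → Ω → Fin (blockSize n M t h) → ℝ)
    (ξ : SampleIndex T n M × Option (Fin p) → Ω → ℝ) : Prop :=
  ∀ᵐ ω ∂μ, ∀ c : SampleIndex T n M, (∀ a, ξ (c, some a) ω = X c.1.1.1 c.1.1.2 ω a c.2) ∧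
    ξ (c, none) ω = z c.1.1.1 c.1.1.2 ω c.2

/-- The entries are only almost everywhere measurable, so they are replaced by measurable versions.
There are countably many of them, so all agree outside a single null set. -/
lemma IsGaussianData.exists_columns (hdata : IsGaussianData μ T p n M σ X z) :
    ∃ ξ : SampleIndex T n M × Option (Fin p) → Ω → ℝ,
      IsGaussianColumns μ σ ξ ∧ AgreesWith μ X z ξ := by
  let g : SampleIndex T n M × Option (Fin p) → EntryIndex T p n M := fun q => ⟨q.1.1, (q.1.2, q.2)⟩
  have hg : Function.Injective g := by
    rintro ⟨⟨b, s⟩, o⟩ ⟨⟨b', s'⟩, o'⟩ h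
    obtain ⟨rfl, h2⟩ := Sigma.mk.inj h
    obtain ⟨rfl, rfl⟩ := Prod.mk.inj (eq_of_heq h2)
    rfl
  have hf : ∀ c a, HasLaw (entry X z (g (c, some a))) (gaussianReal 0 1) μ := fun c a =>
    hdata.feature c.1.1.1 c.1.1.2 c.1.2.1 c.1.2.2.1 c.1.2.2.2 a c.2
  have hn : ∀ c, HasLaw (entry X z (g (c, none))) (gaussianReal 0 (σ ^ 2)) μ := fun c =>
    hdata.noise c.1.1.1 c.1.1.2 c.1.2.1 c.1.2.2.1 c.1.2.2.2 c.2
  have hae : ∀ q, AEMeasurable (entry X z (g q)) μ := by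
    rintro ⟨c, _ | a⟩
    · exact (hn c).aemeasurable
    · exact (hf c a).aemeasurable
  refine ⟨fun q => (hae q).mk, ⟨fun q => (hae q).measurable_mk,
    fun c a => (hf c a).congr (hae _).ae_eq_mk.symm, fun c => (hn c).congr (hae _).ae_eq_mk.symm,
    (hdata.indep.precomp hg).congr fun q => (hae q).ae_eq_mk⟩, ?_⟩
  have hall : ∀ᵐ ω ∂μ, ∀ q, entry X z (g q) ω = (hae q).mk _ ω :=
    ae_all_iff.2 fun q => (hae q).ae_eq_mk
  filter_upwards [hall] with ω hω c
  exact ⟨fun a => (hω (c, some a)).symm, (hω (c, none)).symm⟩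

omit [MeasurableSpace Ω] in
lemma mem_fits_iff {ξ : SampleIndex T n M × Option (Fin p) → Ω → ℝ} {ω : Ω}
    (hω : ∀ c : SampleIndex T n M, (∀ a, ξ (c, some a) ω = X c.1.1.1 c.1.1.2 ω a c.2) ∧
      ξ (c, none) ω = z c.1.1.1 c.1.1.2 ω c.2) (wstar : ℕ → EuclideanSpace ℝ (Fin p))
    (b : BlockIndex T) (u : EuclideanSpace ℝ (Fin p)) :
    u ∈ fits wstar (fun t h => X t h ω) (fun t h => z t h ω) b.1.1 b.1.2 ↔
      ∀ s, inner ℝ (featureVec ξ ⟨b, s⟩ ω) u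
        = inner ℝ (featureVec ξ ⟨b, s⟩ ω) (wstar (blockTask b.1.1 b.1.2)) + ξ (⟨b, s⟩, none) ω := by
  have hinner : ∀ s (v : EuclideanSpace ℝ (Fin p)),
      inner ℝ (featureVec ξ ⟨b, s⟩ ω) v = ((X b.1.1 b.1.2 ω)ᵀ *ᵥ v.ofLp) s := by
    intro s v
    simp only [featureVec, PiLp.inner_apply, Matrix.mulVec, dotProduct, Matrix.transpose_apply,
      (hω ⟨b, s⟩).1]
    exact Finset.sum_congr rfl fun a _ => by simp [mul_comm]
  simp only [fits, Set.mem_ofPred_eq, funext_iff, Pi.add_apply, hinner, (hω ⟨b, _⟩).2]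

variable [IsProbabilityMeasure μ] {ξ : SampleIndex T n M × Option (Fin p) → Ω → ℝ}
  (hξ : IsGaussianColumns μ σ ξ) (hag : AgreesWith μ X z ξ)
  (wstar : ℕ → EuclideanSpace ℝ (Fin p))

include hξ hag in
-- All samples of a block share one ground truth, so the interference term of the general step is
-- zero.
lemma Tracks.fit_block {𝓑 𝓑' : Set (ℕ × ℕ)} {W W₁ : Ω → EuclideanSpace ℝ (Fin p)}
    {e : EuclideanSpace ℝ (Fin p) → ℝ} (h : Tracks μ ξ (samplesOf T n M 𝓑) W e) {t k : ℕ}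
    (htT : t ≤ T) (hk : k < t) (hB : (t, k) ∉ 𝓑) (hBB' : 𝓑 ⊆ 𝓑') (hB' : (t, k) ∈ 𝓑')
    (hsize : blockSize n M t k + 1 < p)
    (hW : ∀ ω, W₁ ω = nearest (fits wstar (fun t h => X t h ω) (fun t h => z t h ω) t k) (W ω)) :
    Tracks μ ξ (samplesOf T n M 𝓑') W₁ fun u =>
      (1 - blockSize n M t k / p) * e u
        + blockSize n M t k / p * ‖wstar (blockTask t k) - u‖ ^ 2
        + Lam p (blockSize n M t k) σ := by
  let b : BlockIndex T := ⟨(t, k), by omega, htT, hk⟩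
  have hc : Function.Injective fun s : Fin (blockSize n M t k) => (⟨b, s⟩ : SampleIndex T n M) :=
    fun s s' h => eq_of_heq (Sigma.mk.inj h).2
  have := h.step hξ (W₁ := W₁) hc (fun _ => hB) (samplesOf_mono hBB') (fun _ => hB')
    (by simpa using hsize) (fun _ => wstar (blockTask t k)) (by
      filter_upwards [hag] with ω hω
      exact ⟨_, fun u => mem_fits_iff hω wstar b u, hW ω⟩)
  convert this using 2 with u
  simp only [Fintype.card_fin, Finset.sum_const, Finset.card_univ, nsmul_eq_mul, sub_self,
    norm_zero, Lam]
  ring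

/-- Mean squared distance to `u` in the inner loop of sequential rehearsal. -/
noncomputable def innerErr (n M : ℕ) (σ : ℝ) (wstar : ℕ → EuclideanSpace ℝ (Fin p)) (t : ℕ)
    (e : ℝ) (u : EuclideanSpace ℝ (Fin p)) : ℕ → ℝ
  | 0 => e
  | m + 1 => (1 - blockSize n M t m / p) * innerErr n M σ wstar t e u m
      + blockSize n M t m / p * ‖wstar (blockTask t m) - u‖ ^ 2 + Lam p (blockSize n M t m) σ

/-- Mean squared distance to `u` in sequential rehearsal. -/
noncomputable def seqErr (n M : ℕ) (σ : ℝ) (wstar : ℕ → EuclideanSpace ℝ (Fin p))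
    (u : EuclideanSpace ℝ (Fin p)) : ℕ → ℝ
  | 0 => ‖u‖ ^ 2
  | t + 1 => innerErr n M σ wstar (t + 1) (seqErr n M σ wstar u t) u (t + 1)

/-- Mean squared distance to `u` in concurrent rehearsal. -/
noncomputable def concErr (n M : ℕ) (σ : ℝ) (wstar : ℕ → EuclideanSpace ℝ (Fin p))
    (u : EuclideanSpace ℝ (Fin p)) : ℕ → ℝ
  | 0 => ‖u‖ ^ 2
  | t + 1 => (1 - (∑ h ∈ range (t + 1), blockSize n M (t + 1) h : ℕ) / p)
        * concErr n M σ wstar u t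
      + (∑ h ∈ range (t + 1), blockSize n M (t + 1) h
          * ‖wstar (blockTask (t + 1) h) - u‖ ^ 2) / p
      + (∑ h ∈ range (t + 1), ∑ k ∈ range (t + 1), blockSize n M (t + 1) h
          * (blockSize n M (t + 1) k
            * ‖wstar (blockTask (t + 1) h) - wstar (blockTask (t + 1) k)‖ ^ 2))
        / (2 * p * (p - (∑ h ∈ range (t + 1), blockSize n M (t + 1) h : ℕ) - 1))
      + Lam p (∑ h ∈ range (t + 1), blockSize n M (t + 1) h : ℕ) σ

include hξ hag in
lemma tracks_sequential (hsize : ∀ t k, t ≤ T → k < t → blockSize n M t k + 1 < p) {t : ℕ}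
    (ht : t ≤ T) :
    Tracks μ ξ (samplesOf T n M {b | b.1 ≤ t})
      (fun ω => sequential wstar (fun t h => X t h ω) (fun t h => z t h ω) t)
      (fun u => seqErr n M σ wstar u t) := by
  induction t with
  | zero => exact tracks_zero _
  | succ t ih =>
    -- Part way through time t + 1 the iterate has seen only earlier times and the first m blocks,
    -- so block m is still fresh.
    have hinner : ∀ m ≤ t + 1,
        Tracks μ ξ (samplesOf T n M {b | b.1 ≤ t ∨ (b.1 = t + 1 ∧ b.2 < m)})
          (fun ω => sequentialInner wstar (fun t h => X t h ω) (fun t h => z t h ω) (t + 1)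
            (sequential wstar (fun t h => X t h ω) (fun t h => z t h ω) t) m)
          (fun u => innerErr n M σ wstar (t + 1) (seqErr n M σ wstar u t) u m) := by
      intro m hm
      induction m with
      | zero => exact (ih (by omega)).mono (samplesOf_mono fun b hb => Or.inl hb)
      | succ m ihm =>
        refine (ihm (by omega)).fit_block hξ hag wstar (t := t + 1) (k := m) ht (by omega) ?_ ?_ ?_
          (hsize _ _ ht (by omega)) fun ω => rfl
        · simp
        · rintro b (hb | hb)
          · exact Or.inl hb
          · exact Or.inr ⟨hb.1, by omega⟩
        · exact Or.inr ⟨rfl, by simp⟩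
    refine (hinner (t + 1) le_rfl).mono (samplesOf_mono ?_)
    rintro b (hb | hb)
    · exact Nat.le_succ_of_le hb
    · exact hb.1.le

include hξ hag in
lemma tracks_concurrent
    (hsize : ∀ t < T, ∑ h ∈ range (t + 1), blockSize n M (t + 1) h + 1 < p) {t : ℕ} (ht : t ≤ T) :
    Tracks μ ξ (samplesOf T n M {b | b.1 ≤ t})
      (fun ω => concurrent wstar (fun t h => X t h ω) (fun t h => z t h ω) t)
      (fun u => concErr n M σ wstar u t) := by
  induction t with
  | zero => exact tracks_zero _
  | succ t ih =>
    -- All blocks of the current time are merged into one frame, indexed by pairs (block, sample).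
    let b : Fin (t + 1) → BlockIndex T := fun h => ⟨(t + 1, h), by simp, ht, h.2⟩
    let c : (Σ h : Fin (t + 1), Fin (blockSize n M (t + 1) h)) → SampleIndex T n M :=
      fun q => ⟨b q.1, q.2⟩
    have hc : Function.Injective c := by
      rintro ⟨h, s⟩ ⟨h', s'⟩ hq
      obtain ⟨h1, h2⟩ := Sigma.mk.inj hq
      have h3 : h = h' := Fin.ext (Prod.mk.inj (Subtype.mk.inj h1)).2
      subst h3
      exact congrArg _ (eq_of_heq h2)
    have hcard : Fintype.card (Σ h : Fin (t + 1), Fin (blockSize n M (t + 1) h))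
        = ∑ h ∈ range (t + 1), blockSize n M (t + 1) h := by
      rw [Fintype.card_sigma, ← Fin.sum_univ_eq_sum_range]
      simp
    have := (ih (by omega)).step hξ
      (W₁ := fun ω => concurrent wstar (fun t h => X t h ω) (fun t h => z t h ω) (t + 1))
      (B' := samplesOf T n M {b | b.1 ≤ t + 1}) hc
      (fun q hq => by simp [samplesOf, c, b] at hq) (samplesOf_mono fun b hb => Nat.le_succ_of_le hb)
      (fun q => le_refl (t + 1)) (by rw [hcard]; exact hsize t (by omega))
      (fun q => wstar (blockTask (t + 1) q.1)) (by
        filter_upwards [hag] with ω hω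
        refine ⟨_, fun u => ?_, rfl⟩
        simp only [Set.mem_ofPred_eq]
        constructor
        · rintro h ⟨k, s⟩
          exact (mem_fits_iff hω wstar (b k) u).1 (h k k.2) s
        · intro h k hk
          exact (mem_fits_iff hω wstar (b ⟨k, hk⟩) u).2 fun s => h ⟨⟨k, hk⟩, s⟩)
    convert this using 2 with u
    rw [hcard, concErr]
    simp only [Fintype.sum_sigma, Finset.sum_const, Finset.card_univ, Fintype.card_fin,
      nsmul_eq_mul, Lam]
    simp only [Finset.mul_sum, ← Fin.sum_univ_eq_sum_range]

end Schemes

/-! ### Closed forms of the recursions -/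

section ClosedForms

variable {p n M : ℕ}

/-- The coefficient depends only on t - l. Passing from t to t + 1 therefore shifts l and adds a new
term at l = 0, and each closed form below is proved by splitting off that term. -/
lemma B_succ_succ (l t : ℕ) : B p M (l + 1) (t + 1) = B p M l t := by
  simp only [B, add_left_inj]
  congr 3
  push_cast
  ring

lemma B_zero_succ {t : ℕ} (ht : 1 ≤ t) : B p M 0 (t + 1) = M / t / p := by
  rw [B, if_neg (by omega), div_div]
  push_cast
  congr 2
  ring

lemma H_succ_succ (l t : ℕ) : H p n M (l + 1) (t + 1) = H p n M l t := by
  rw [H, B_succ_succ, H]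

lemma Delta_succ (t a : ℕ) :
    Delta p n M (t + 1) (a + 1) = (1 - B p M 0 (t + 1)) ^ t * r p n 0 * Delta p n M t a := by
  rw [Delta, Finset.prod_range_succ', Delta, mul_comm]
  congr 1
  refine Finset.prod_congr rfl fun l _ => ?_
  rw [B_succ_succ, show t + 1 - (l + 1) - 1 = t - l - 1 by omega]

lemma Delta_zero (t : ℕ) : Delta p n M t 0 = 1 := by simp [Delta]

lemma cast_blockSize_succ {t h : ℕ} (htM : t ∣ M) :
    (blockSize n M (t + 1) (h + 1) : ℝ) = M / t := by
  rcases Nat.eq_zero_or_pos t with rfl | ht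
  · simp [blockSize]
  · simp only [blockSize, Nat.add_eq_zero_iff, one_ne_zero, and_false, if_false,
      Nat.add_sub_cancel]
    exact Nat.cast_div htM (by positivity)

/-! #### Sequential rehearsal -/

/-- Coefficient of the distance to the ground truth of task `j` in sequential rehearsal. -/
noncomputable def seqCoef (p n M j t : ℕ) : ℝ :=
  if j < t then
    (1 - r p n 0) * (1 - B p M (t - j) t) ^ (j - 1) * Delta p n M t (t - j)
      + ∑ l ∈ range (t - j), Delta p n M t l * (1 - B p M l t) ^ (t - j - l - 1) * B p M l t
  else (1 - r p n 0) * (1 - B p M 0 t) ^ (t - 1)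

lemma seqCoef_self (t : ℕ) :
    seqCoef p n M (t + 1) (t + 1) = (1 - r p n 0) * (1 - B p M 0 (t + 1)) ^ t := by
  simp [seqCoef]

/-- One time step damps an old contribution by r₀ for the current data and by 1 - B for each of the
t memory sets. The memory of task j contributes B anew, damped by the t - j sets fitted after it. -/
lemma seqCoef_succ {j t : ℕ} (hjt : j ≤ t) :
    seqCoef p n M j (t + 1) = (1 - B p M 0 (t + 1)) ^ t * r p n 0 * seqCoef p n M j t
      + (1 - B p M 0 (t + 1)) ^ (t - j) * B p M 0 (t + 1) := by
  rw [seqCoef, if_pos (by omega), show t + 1 - j = t - j + 1 by omega, Finset.sum_range_succ',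
    Delta_zero, Delta_succ, B_succ_succ]
  have h1 : ∑ l ∈ range (t - j), Delta p n M (t + 1) (l + 1)
        * (1 - B p M (l + 1) (t + 1)) ^ (t - j + 1 - (l + 1) - 1) * B p M (l + 1) (t + 1)
      = (1 - B p M 0 (t + 1)) ^ t * r p n 0 * ∑ l ∈ range (t - j),
        Delta p n M t l * (1 - B p M l t) ^ (t - j - l - 1) * B p M l t := by
    rw [Finset.mul_sum]
    refine Finset.sum_congr rfl fun l _ => ?_
    rw [Delta_succ, B_succ_succ, show t - j + 1 - (l + 1) - 1 = t - j - l - 1 by omega]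
    ring
  rw [h1, show t - j + 1 - 0 - 1 = t - j by omega, seqCoef]
  split_ifs with h
  · ring
  -- For j = t the coefficient at time t is given by the second branch, with which the first formula
  -- agrees at t - j = 0.
  · obtain rfl : j = t := by omega
    simp only [Nat.sub_self, Finset.range_zero, Finset.sum_empty, Delta_zero]
    ring

lemma d0Seq_succ {t : ℕ} (ht : 1 ≤ t) :
    d0Seq p n M (t + 1) = (1 - B p M 0 (t + 1)) ^ t * r p n 0 * d0Seq p n M t := by
  obtain ⟨s, rfl⟩ := Nat.exists_eq_add_of_le' ht
  rw [d0Seq, d0Seq, Nat.add_sub_cancel, Nat.add_sub_cancel, Delta_succ]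
  ring

lemma noiseSeq_succ {t : ℕ} (ht : 1 ≤ t) (σ : ℝ) :
    noiseSeq p n M (t + 1) σ = (1 - B p M 0 (t + 1)) ^ t * r p n 0 * noiseSeq p n M t σ
      + ((1 - B p M 0 (t + 1)) ^ t * Lam p n σ
        + ∑ h ∈ Icc 1 t, (1 - B p M 0 (t + 1)) ^ (t - h) * Lam p (M / t) σ) := by
  obtain ⟨s, rfl⟩ := Nat.exists_eq_add_of_le' ht
  have h1 : (M : ℝ) / (((s + 1 + 1 : ℕ) : ℝ) - ((0 : ℕ) : ℝ) - 1) = M / ((s + 1 : ℕ) : ℝ) := by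
    push_cast
    congr 1
    ring
  have h2 : ∀ l : ℕ, (((s + 1 + 1 : ℕ) : ℝ) - ((l + 1 : ℕ) : ℝ) - 1)
      = ((s + 1 : ℕ) : ℝ) - (l : ℝ) - 1 := fun l => by
    push_cast
    ring
  rw [noiseSeq, noiseSeq, Nat.add_sub_cancel, Nat.add_sub_cancel, Delta_succ,
    Finset.sum_range_succ', Delta_zero, one_mul, h1, mul_add, Finset.mul_sum]
  simp only [h2, Delta_succ, B_succ_succ, mul_assoc, Nat.sub_zero,
    Nat.succ_sub_succ_eq_sub]
  ring

/-- Inner step 0 fits the current data; the next m fit memory sets of one common size, so the affine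
recursion unrolls with a constant ratio. -/
lemma innerErr_succ_eq {σ : ℝ} (wstar : ℕ → EuclideanSpace ℝ (Fin p)) (e : ℝ)
    (u : EuclideanSpace ℝ (Fin p)) {t : ℕ} (htM : t ∣ M) {m : ℕ} (hm : m ≤ t) :
    innerErr n M σ wstar (t + 1) e u (m + 1)
      = (1 - B p M 0 (t + 1)) ^ m
          * (r p n 0 * e + (1 - r p n 0) * ‖wstar (t + 1) - u‖ ^ 2 + Lam p n σ)
        + ∑ h ∈ Icc 1 m, (1 - B p M 0 (t + 1)) ^ (m - h)
          * (B p M 0 (t + 1) * ‖wstar h - u‖ ^ 2 + Lam p (M / t) σ) := by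
  induction m with
  | zero => simp [innerErr, blockSize, blockTask, r]
  | succ m ih =>
    rw [innerErr, ih (by omega), Finset.sum_Icc_succ_top (by omega), Nat.sub_self, pow_zero,
      one_mul, cast_blockSize_succ htM, ← B_zero_succ (p := p) (M := M) (by omega : 1 ≤ t)]
    have h1 : ∑ h ∈ Icc 1 m, (1 - B p M 0 (t + 1)) ^ (m + 1 - h)
          * (B p M 0 (t + 1) * ‖wstar h - u‖ ^ 2 + Lam p (M / t) σ)
        = (1 - B p M 0 (t + 1)) * ∑ h ∈ Icc 1 m, (1 - B p M 0 (t + 1)) ^ (m - h)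
          * (B p M 0 (t + 1) * ‖wstar h - u‖ ^ 2 + Lam p (M / t) σ) := by
      rw [Finset.mul_sum]
      refine Finset.sum_congr rfl fun h hh => ?_
      rw [Nat.sub_add_comm (Finset.mem_Icc.1 hh).2, pow_succ]
      ring
    rw [h1, show blockTask (t + 1) (m + 1) = m + 1 by simp [blockTask]]
    ring

theorem seqErr_eq {σ : ℝ} (wstar : ℕ → EuclideanSpace ℝ (Fin p))
    (u : EuclideanSpace ℝ (Fin p)) {t : ℕ} (ht : 1 ≤ t) (hM : ∀ s, 1 ≤ s → s < t → s ∣ M) :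
    seqErr n M σ wstar u t = d0Seq p n M t * ‖u‖ ^ 2
      + ∑ j ∈ Icc 1 t, seqCoef p n M j t * ‖wstar j - u‖ ^ 2 + noiseSeq p n M t σ := by
  induction t, ht using Nat.le_induction with
  | base => simp [seqErr, innerErr, blockSize, blockTask, r, d0Seq, seqCoef, noiseSeq, Delta]
  | succ t ht ih =>
    rw [seqErr, ih fun s h1 h2 => hM s h1 (by omega), innerErr_succ_eq wstar _ u
      (hM t ht (by omega)) le_rfl, d0Seq_succ ht, noiseSeq_succ ht,
      Finset.sum_Icc_succ_top (by omega), seqCoef_self]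
    have h1 : ∑ j ∈ Icc 1 t, seqCoef p n M j (t + 1) * ‖wstar j - u‖ ^ 2
        = (1 - B p M 0 (t + 1)) ^ t * r p n 0
            * ∑ j ∈ Icc 1 t, seqCoef p n M j t * ‖wstar j - u‖ ^ 2
          + ∑ j ∈ Icc 1 t, (1 - B p M 0 (t + 1)) ^ (t - j)
            * (B p M 0 (t + 1) * ‖wstar j - u‖ ^ 2) := by
      rw [Finset.mul_sum, ← Finset.sum_add_distrib]
      refine Finset.sum_congr rfl fun j hj => ?_
      rw [seqCoef_succ (Finset.mem_Icc.1 hj).2]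
      ring
    rw [h1]
    simp only [mul_add, Finset.sum_add_distrib]
    ring

lemma sum_dSeq {T t i : ℕ} (ht : t ∈ Icc 1 T) (hi : i ∈ Icc 1 T)
    (wstar : ℕ → EuclideanSpace ℝ (Fin p)) :
    ∑ j ∈ Icc 1 T, ∑ k ∈ Icc 1 T, dSeq p n M i j k t * ‖wstar j - wstar k‖ ^ 2
      = ∑ j ∈ Icc 1 t, seqCoef p n M j t * ‖wstar j - wstar i‖ ^ 2 := by
  have h1 : ∀ j, ∑ k ∈ Icc 1 T, dSeq p n M i j k t * ‖wstar j - wstar k‖ ^ 2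
      = dSeq p n M i j i t * ‖wstar j - wstar i‖ ^ 2 := fun j => by
    refine Finset.sum_eq_single_of_mem i hi fun k _ hk => ?_
    simp [dSeq, hk]
  simp_rw [h1]
  rw [← Finset.sum_subset (Finset.Icc_subset_Icc_right (Finset.mem_Icc.1 ht).2)]
  · refine Finset.sum_congr rfl fun j hj => ?_
    congr 1
    obtain ⟨_, hj⟩ := Finset.mem_Icc.1 hj
    rcases hj.lt_or_eq with h | rfl
    · simp [dSeq, seqCoef, h]
    · simp [dSeq, seqCoef]
  · intro j hj hj'
    have hjt : t < j := by
      simp only [Finset.mem_Icc] at hj hj'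
      omega
    simp [dSeq, hjt.not_gt, hjt.ne']

/-! #### Concurrent rehearsal -/

/-- Coefficient of the distance to the ground truth of task `j` in concurrent rehearsal, without
the interference between tasks. -/
noncomputable def concCoef (p n M j t : ℕ) : ℝ :=
  (1 - r p n 0) * r p n M ^ (t - j) + ∑ l ∈ range (t - j), r p n M ^ l * B p M l t

lemma concCoef_succ {j t : ℕ} (hjt : j ≤ t) :
    concCoef p n M j (t + 1) = r p n M * concCoef p n M j t + B p M 0 (t + 1) := by
  rw [concCoef, concCoef, show t + 1 - j = t - j + 1 by omega, Finset.sum_range_succ', mul_add,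
    Finset.mul_sum]
  simp only [B_succ_succ, pow_succ', pow_zero, one_mul, mul_assoc]
  ring

lemma interference_succ {m t : ℕ} (hmt : m ≤ t) :
    interference p n M m (t + 1)
      = r p n M * interference p n M m t + p * B p M 0 (t + 1) * H p n M 0 (t + 1) := by
  rw [interference, interference, if_pos hmt, if_pos (by omega),
    show t + 1 - m = t - m + 1 by omega, Finset.sum_range_succ', mul_add, Finset.mul_sum]
  simp only [B_succ_succ, H_succ_succ, pow_succ', pow_zero, mul_one, mul_assoc]
  rw [← add_assoc]
  congr 2
  exact Finset.sum_congr rfl fun l _ => by ring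

/-- A task just arrived meets each earlier task with n current samples against that task's memory
samples; the interference between two memory sets, with weight pBH, only begins one time step later.
-/
lemma interference_self (t : ℕ) : interference p n M t t = n * H p n M 0 t := by
  simp [interference]

lemma interference_of_lt {m t : ℕ} (h : t < m) : interference p n M m t = 0 := by
  rw [interference, if_neg (by omega)]

lemma d0Conc_succ {t : ℕ} (ht : 1 ≤ t) : d0Conc p n M (t + 1) = r p n M * d0Conc p n M t := by
  obtain ⟨s, rfl⟩ := Nat.exists_eq_add_of_le' ht
  simp only [d0Conc, Nat.add_sub_cancel, pow_succ]
  ring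

lemma noiseConc_succ {t : ℕ} (ht : 1 ≤ t) (σ : ℝ) :
    noiseConc p n M (t + 1) σ = r p n M * noiseConc p n M t σ + Lam p (n + M) σ := by
  obtain ⟨s, rfl⟩ := Nat.exists_eq_add_of_le' ht
  simp only [noiseConc, Nat.add_sub_cancel]
  rw [Finset.sum_range_succ', mul_add, Finset.mul_sum]
  simp only [pow_succ', pow_zero, one_mul, mul_assoc]
  rw [add_assoc]

lemma sum_blockSize_succ {t : ℕ} (htM : t ∣ M) :
    ∑ h ∈ range (t + 1), blockSize n M (t + 1) h = n + M := by
  rw [Finset.sum_range_succ']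
  simp only [blockSize, Nat.add_eq_zero_iff, one_ne_zero, and_false, if_false, if_true,
    Nat.add_sub_cancel, Finset.sum_const, Finset.card_range, smul_eq_mul]
  rw [Nat.mul_div_cancel' htM, add_comm]

lemma sum_Icc_sum_Icc_succ_of_symm {f : ℕ → ℕ → ℝ} (hs : ∀ j k, f j k = f k j)
    (h0 : ∀ j, f j j = 0) (t : ℕ) :
    ∑ j ∈ Icc 1 (t + 1), ∑ k ∈ Icc 1 (t + 1), f j k
      = ∑ j ∈ Icc 1 t, ∑ k ∈ Icc 1 t, f j k + 2 * ∑ j ∈ Icc 1 t, f j (t + 1) := by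
  simp only [Finset.sum_Icc_succ_top (show 1 ≤ t + 1 by omega), Finset.sum_add_distrib, h0,
    fun k => hs (t + 1) k]
  ring

/-- The pair sum is kept symmetric and halved, matching the form produced by one update. The
induction then adds each pair containing the new task twice. -/
theorem concErr_eq {σ : ℝ} (hp : n + M + 1 < p) (wstar : ℕ → EuclideanSpace ℝ (Fin p))
    (u : EuclideanSpace ℝ (Fin p)) {t : ℕ} (ht : 1 ≤ t) (hM : ∀ s, 1 ≤ s → s < t → s ∣ M) :
    concErr n M σ wstar u t = d0Conc p n M t * ‖u‖ ^ 2
      + ∑ j ∈ Icc 1 t, concCoef p n M j t * ‖wstar j - u‖ ^ 2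
      + (∑ j ∈ Icc 1 t, ∑ k ∈ Icc 1 t,
          interference p n M (max j k) t * ‖wstar j - wstar k‖ ^ 2) / 2
      + noiseConc p n M t σ := by
  induction t, ht using Nat.le_induction with
  | base =>
    simp [concErr, blockSize, blockTask, r, d0Conc, concCoef, noiseConc]
    ring
  | succ t ht ih =>
    have htM := hM t ht (by omega)
    have hp' : (n : ℝ) + M + 1 < p := by exact_mod_cast hp
    have hp0 : (0 : ℝ) < p := by
      have : 0 < p := by omega
      exact_mod_cast this
    have hD : (p : ℝ) - (n + M) - 1 ≠ 0 := by linarith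
    rw [concErr, sum_blockSize_succ htM, ih fun s h1 h2 => hM s h1 (by omega), d0Conc_succ ht,
      noiseConc_succ ht, Finset.sum_Icc_succ_top (by omega),
      sum_Icc_sum_Icc_succ_of_symm (f := fun j k => interference p n M (max j k) (t + 1)
        * ‖wstar j - wstar k‖ ^ 2) (fun j k => by rw [max_comm, norm_sub_rev]) (by simp)]
    -- With block 0 split off, memory block h + 1 belongs to task h + 1, so sums over memory blocks
    -- become sums over tasks 1 to t.
    have hshift : ∀ f : ℕ → ℝ, ∑ h ∈ range t, f (h + 1) = ∑ h ∈ Icc 1 t, f h := fun f => by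
      rw [Finset.range_eq_Ico, Finset.sum_Ico_add' f 0 t 1, zero_add]
      rfl
    have hb0 : ((blockSize n M (t + 1) 0 : ℕ) : ℝ) = n := by simp [blockSize]
    have ht0 : blockTask (t + 1) 0 = t + 1 := by simp [blockTask]
    have ht1 : ∀ h, blockTask (t + 1) (h + 1) = h + 1 := by simp [blockTask]
    simp only [Finset.sum_range_succ' _ t, hb0, cast_blockSize_succ htM, ht0, ht1, sub_self,
      norm_zero]
    have e1 := hshift fun h => (M / t : ℝ) * ‖wstar h - u‖ ^ 2
    have e2 := hshift fun h => (n : ℝ) * ((M / t : ℝ) * ‖wstar (t + 1) - wstar h‖ ^ 2)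
    have e3 := hshift fun h => (M / t : ℝ) * ((n : ℝ) * ‖wstar h - wstar (t + 1)‖ ^ 2)
    have e4 : ∑ h ∈ range t, ∑ k ∈ range t,
          (M / t : ℝ) * ((M / t : ℝ) * ‖wstar (h + 1) - wstar (k + 1)‖ ^ 2)
        = ∑ h ∈ Icc 1 t, ∑ k ∈ Icc 1 t, (M / t : ℝ) * ((M / t : ℝ) * ‖wstar h - wstar k‖ ^ 2) := by
      rw [← hshift]
      exact Finset.sum_congr rfl fun h _ => hshift fun k =>
        (M / t : ℝ) * ((M / t : ℝ) * ‖wstar (h + 1) - wstar k‖ ^ 2)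
    simp only [Finset.sum_add_distrib]
    rw [e1, e2, e3, e4]
    have e5 : ∑ j ∈ Icc 1 t, concCoef p n M j (t + 1) * ‖wstar j - u‖ ^ 2
        = r p n M * ∑ j ∈ Icc 1 t, concCoef p n M j t * ‖wstar j - u‖ ^ 2
          + B p M 0 (t + 1) * ∑ j ∈ Icc 1 t, ‖wstar j - u‖ ^ 2 := by
      rw [Finset.mul_sum, Finset.mul_sum, ← Finset.sum_add_distrib]
      refine Finset.sum_congr rfl fun j hj => ?_
      rw [concCoef_succ (Finset.mem_Icc.1 hj).2]
      ring
    have e6 : ∑ j ∈ Icc 1 t, ∑ k ∈ Icc 1 t,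
          interference p n M (max j k) (t + 1) * ‖wstar j - wstar k‖ ^ 2
        = r p n M * ∑ j ∈ Icc 1 t, ∑ k ∈ Icc 1 t,
            interference p n M (max j k) t * ‖wstar j - wstar k‖ ^ 2
          + p * B p M 0 (t + 1) * H p n M 0 (t + 1)
            * ∑ j ∈ Icc 1 t, ∑ k ∈ Icc 1 t, ‖wstar j - wstar k‖ ^ 2 := by
      simp only [Finset.mul_sum, ← Finset.sum_add_distrib]
      refine Finset.sum_congr rfl fun j hj => Finset.sum_congr rfl fun k hk => ?_
      rw [interference_succ (max_le (Finset.mem_Icc.1 hj).2 (Finset.mem_Icc.1 hk).2)]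
      ring
    have e7 : ∑ j ∈ Icc 1 t,
          interference p n M (max j (t + 1)) (t + 1) * ‖wstar j - wstar (t + 1)‖ ^ 2
        = n * H p n M 0 (t + 1) * ∑ j ∈ Icc 1 t, ‖wstar j - wstar (t + 1)‖ ^ 2 := by
      rw [Finset.mul_sum]
      refine Finset.sum_congr rfl fun j hj => ?_
      rw [max_eq_right ((Finset.mem_Icc.1 hj).2.trans (Nat.le_succ t)), interference_self]
    have e8 : concCoef p n M (t + 1) (t + 1) = 1 - r p n 0 := by simp [concCoef]
    rw [e5, e6, e7, e8]
    simp only [H, B_zero_succ ht, ← Finset.mul_sum, norm_sub_rev (wstar (t + 1)) (wstar _), r]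
    push_cast
    have ht' : (t : ℝ) ≠ 0 := by positivity
    have hD' : (p : ℝ) - n - M - 1 ≠ 0 := by linarith
    rw [show (p : ℝ) - (n + M) - 1 = p - n - M - 1 by ring]
    field_simp
    ring

/-- The stated coefficients keep exactly one order of each unordered pair: `i` goes second if it
belongs to the pair, otherwise the larger index does. This selects half of the symmetric sum. -/
lemma sum_dConc {T t i : ℕ} (ht : t ∈ Icc 1 T) (hi : i ∈ Icc 1 T)
    (wstar : ℕ → EuclideanSpace ℝ (Fin p)) :
    ∑ j ∈ Icc 1 T, ∑ k ∈ Icc 1 T, dConc p n M i j k t * ‖wstar j - wstar k‖ ^ 2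
      = ∑ j ∈ Icc 1 t, concCoef p n M j t * ‖wstar j - wstar i‖ ^ 2
        + (∑ j ∈ Icc 1 t, ∑ k ∈ Icc 1 t,
            interference p n M (max j k) t * ‖wstar j - wstar k‖ ^ 2) / 2 := by
  have hsub : Icc 1 t ⊆ Icc 1 T := Finset.Icc_subset_Icc_right (Finset.mem_Icc.1 ht).2
  have hlt : ∀ j ∈ Icc 1 T, j ∉ Icc 1 t → t < j := fun j hj hj' => by
    simp only [Finset.mem_Icc] at hj hj'
    omega
  set S : ℕ → ℕ → ℝ := fun j k => interference p n M (max j k) t * ‖wstar j - wstar k‖ ^ 2 with hS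
  have hsymm : ∀ j k, S j k = S k j := fun j k => by simp only [hS, max_comm, norm_sub_rev]
  have hdiag : ∀ j, S j j = 0 := fun j => by simp [hS]
  have hbig : ∑ j ∈ Icc 1 t, ∑ k ∈ Icc 1 t, S j k = ∑ j ∈ Icc 1 T, ∑ k ∈ Icc 1 T, S j k := by
    have h1 : ∀ j, ∑ k ∈ Icc 1 t, S j k = ∑ k ∈ Icc 1 T, S j k := fun j =>
      Finset.sum_subset hsub fun k hk hk' => by
        simp [hS, interference_of_lt (lt_max_of_lt_right (a := t) (b := j) (hlt k hk hk'))]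
    simp_rw [h1]
    exact Finset.sum_subset hsub fun j hj hj' => Finset.sum_eq_zero fun k _ => by
      simp [hS, interference_of_lt (lt_max_of_lt_left (a := t) (c := k) (hlt j hj hj'))]
  have hcoef : ∑ j ∈ Icc 1 t, concCoef p n M j t * ‖wstar j - wstar i‖ ^ 2
      = ∑ j ∈ Icc 1 T, ∑ k ∈ Icc 1 T,
        (if k = i ∧ j ≤ t then concCoef p n M j t * ‖wstar j - wstar k‖ ^ 2 else 0) := by
    have h1 : ∀ j, ∑ k ∈ Icc 1 T,
        (if k = i ∧ j ≤ t then concCoef p n M j t * ‖wstar j - wstar k‖ ^ 2 else 0)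
        = if j ≤ t then concCoef p n M j t * ‖wstar j - wstar i‖ ^ 2 else 0 := fun j => by
      rw [Finset.sum_eq_single_of_mem i hi fun k _ hk => by simp [hk]]
      simp
    simp_rw [h1]
    rw [← Finset.sum_subset hsub fun j hj hj' => if_neg (hlt j hj hj').not_ge]
    exact Finset.sum_congr rfl fun j hj => (if_pos (Finset.mem_Icc.1 hj).2).symm
  set φ : ℕ → ℕ → ℝ := fun j k => if k = i ∨ (j < k ∧ j ≠ i) then S j k else 0 with hφ
  -- For every pair exactly one of `φ j k` and `φ k j` carries the value `S j k`; diagonal terms are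
  -- zero.
  have hhalf : ∑ j ∈ Icc 1 T, ∑ k ∈ Icc 1 T, φ j k
      = (∑ j ∈ Icc 1 T, ∑ k ∈ Icc 1 T, S j k) / 2 := by
    have h1 : ∑ j ∈ Icc 1 T, ∑ k ∈ Icc 1 T, φ j k = ∑ j ∈ Icc 1 T, ∑ k ∈ Icc 1 T, φ k j :=
      Finset.sum_comm
    have h2 : ∑ j ∈ Icc 1 T, ∑ k ∈ Icc 1 T, φ j k + ∑ j ∈ Icc 1 T, ∑ k ∈ Icc 1 T, φ k j
        = ∑ j ∈ Icc 1 T, ∑ k ∈ Icc 1 T, S j k := by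
      simp only [← Finset.sum_add_distrib]
      refine Finset.sum_congr rfl fun j _ => Finset.sum_congr rfl fun k _ => ?_
      simp only [hφ]
      rcases eq_or_ne j k with rfl | hjk
      · simp [hdiag]
      · rw [hsymm k j]
        rcases eq_or_ne k i with rfl | hki
        · simp [hjk]
        · rcases eq_or_ne j i with rfl | hji
          · simp [hki]
          · rcases lt_or_gt_of_ne hjk with h | h
            · simp [hki, hji, h, h.not_gt]
            · simp [hki, hji, h, h.not_gt]
    linarith
  rw [hbig, ← hhalf, hcoef, ← Finset.sum_add_distrib]
  refine Finset.sum_congr rfl fun j hj => ?_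
  rw [← Finset.sum_add_distrib]
  refine Finset.sum_congr rfl fun k hk => ?_
  simp only [hφ, hS, dConc, concCoef]
  by_cases hki : k = i
  · subst hki
    by_cases hjt : j ≤ t
    · simp only [hjt, and_self, if_true, true_or, max_comm k j]
      ring
    · have : interference p n M (max j k) t = 0 := interference_of_lt (lt_max_of_lt_left (by omega))
      simp [hjt, this]
  · by_cases hjk : j < k ∧ j ≠ i
    · simp [hki, hjk, max_eq_right hjk.1.le]
    · simp [hki, hjk]

end ClosedForms

/-! ### Forgetting and generalization error -/

lemma forgetting_eq_and_genError_eq {Ω : Type*} [MeasurableSpace Ω] {μ : Measure Ω} {p T : ℕ}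
    (hT : 2 ≤ T) {wstar : ℕ → EuclideanSpace ℝ (Fin p)} {W : ℕ → Ω → EuclideanSpace ℝ (Fin p)}
    {d₀ : ℕ → ℝ} {d : ℕ → ℕ → ℕ → ℕ → ℝ} {ν : ℕ → ℝ}
    (h : ∀ t ∈ Icc 1 T, ∀ i ∈ Icc 1 T, Integrable (fun ω => modelError wstar i (W t ω)) μ ∧
      ∫ ω, modelError wstar i (W t ω) ∂μ = d₀ t * ‖wstar i‖ ^ 2
        + ∑ j ∈ Icc 1 T, ∑ k ∈ Icc 1 T, d i j k t * ‖wstar j - wstar k‖ ^ 2 + ν t) :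
    forgetting μ wstar W T = 1 / ((T : ℝ) - 1) *
      (∑ i ∈ Icc 1 (T - 1), (d₀ T - d₀ i) * ‖wstar i‖ ^ 2
        + ∑ i ∈ Icc 1 (T - 1), ∑ j ∈ Icc 1 T, ∑ k ∈ Icc 1 T,
            (d i j k T - d i j k i) * ‖wstar j - wstar k‖ ^ 2
        + ∑ i ∈ Icc 1 (T - 1), (ν T - ν i)) ∧
    genError μ wstar W T = 1 / (T : ℝ) *
      (d₀ T * ∑ i ∈ Icc 1 T, ‖wstar i‖ ^ 2
        + ∑ i ∈ Icc 1 T, ∑ j ∈ Icc 1 T, ∑ k ∈ Icc 1 T,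
            d i j k T * ‖wstar j - wstar k‖ ^ 2) + ν T := by
  have hTT : T ∈ Icc 1 T := Finset.mem_Icc.2 ⟨by omega, le_rfl⟩
  constructor
  · rw [forgetting, ← Finset.sum_add_distrib, ← Finset.sum_add_distrib]
    congr 1
    refine Finset.sum_congr rfl fun i hi => ?_
    have hiT : i ∈ Icc 1 T := Finset.Icc_subset_Icc_right (Nat.sub_le T 1) hi
    rw [integral_sub (h T hTT i hiT).1 (h i hiT i hiT).1, (h T hTT i hiT).2, (h i hiT i hiT).2]
    simp only [sub_mul, Finset.sum_sub_distrib]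
    ring
  · rw [genError, Finset.sum_congr rfl fun i hi => (h T hTT i hi).2, Finset.sum_add_distrib,
      Finset.sum_add_distrib, ← Finset.mul_sum, Finset.sum_const, Nat.card_Icc, nsmul_eq_mul,
      Nat.add_sub_cancel, mul_add]
    have : (T : ℝ) ≠ 0 := by positivity
    field_simp

end Rehearsal

theorem mainTheorem2 {Ω : Type*} [MeasurableSpace Ω] (μ : Measure Ω) [IsProbabilityMeasure μ]
    (T p n M : ℕ) (hT : 2 ≤ T) (hn : 1 ≤ n) (hp : n + M < p) (hp' : n + 1 < p)
    (hM : ∀ t ∈ Finset.Icc 2 T, t - 1 ∣ M) (σ : ℝ≥0)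
    (wstar : ℕ → EuclideanSpace ℝ (Fin p))
    (X : (t h : ℕ) → Ω → Matrix (Fin p) (Fin (blockSize n M t h)) ℝ)
    (z : (t h : ℕ) → Ω → Fin (blockSize n M t h) → ℝ)
    (hdata : IsGaussianData μ T p n M σ X z)
    (Wc Ws : ℕ → Ω → EuclideanSpace ℝ (Fin p))
    (hWc : ∀ t ω, Wc t ω = concurrent wstar (fun t h => X t h ω) (fun t h => z t h ω) t)
    (hWs : ∀ t ω, Ws t ω = sequential wstar (fun t h => X t h ω) (fun t h => z t h ω) t) :
    -- concurrent rehearsal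
    (n + M + 1 < p →
      (∀ t ∈ Finset.Icc 1 T, ∀ i ∈ Finset.Icc 1 T,
        Integrable (fun ω => modelError wstar i (Wc t ω)) μ ∧
        ∫ ω, modelError wstar i (Wc t ω) ∂μ
          = d0Conc p n M t * ‖wstar i‖ ^ 2
            + ∑ j ∈ Finset.Icc 1 T, ∑ k ∈ Finset.Icc 1 T,
                dConc p n M i j k t * ‖wstar j - wstar k‖ ^ 2
            + noiseConc p n M t σ) ∧
      forgetting μ wstar Wc T
        = 1 / ((T : ℝ) - 1) *
          (∑ i ∈ Finset.Icc 1 (T - 1), cConc p n M T i * ‖wstar i‖ ^ 2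
            + ∑ i ∈ Finset.Icc 1 (T - 1), ∑ j ∈ Finset.Icc 1 T, ∑ k ∈ Finset.Icc 1 T,
                cConc₃ p n M T i j k * ‖wstar j - wstar k‖ ^ 2
            + ∑ i ∈ Finset.Icc 1 (T - 1), (noiseConc p n M T σ - noiseConc p n M i σ)) ∧
      genError μ wstar Wc T
        = 1 / (T : ℝ) *
          (d0Conc p n M T * ∑ i ∈ Finset.Icc 1 T, ‖wstar i‖ ^ 2
            + ∑ i ∈ Finset.Icc 1 T, ∑ j ∈ Finset.Icc 1 T, ∑ k ∈ Finset.Icc 1 T,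
                dConc p n M i j k T * ‖wstar j - wstar k‖ ^ 2)
          + noiseConc p n M T σ) ∧
    -- sequential rehearsal
    ((∀ t ∈ Finset.Icc 1 T, ∀ i ∈ Finset.Icc 1 T,
        Integrable (fun ω => modelError wstar i (Ws t ω)) μ ∧
        ∫ ω, modelError wstar i (Ws t ω) ∂μ
          = d0Seq p n M t * ‖wstar i‖ ^ 2
            + ∑ j ∈ Finset.Icc 1 T, ∑ k ∈ Finset.Icc 1 T,
                dSeq p n M i j k t * ‖wstar j - wstar k‖ ^ 2
            + noiseSeq p n M t σ) ∧
      forgetting μ wstar Ws T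
        = 1 / ((T : ℝ) - 1) *
          (∑ i ∈ Finset.Icc 1 (T - 1), cSeq p n M T i * ‖wstar i‖ ^ 2
            + ∑ i ∈ Finset.Icc 1 (T - 1), ∑ j ∈ Finset.Icc 1 T, ∑ k ∈ Finset.Icc 1 T,
                cSeq₃ p n M T i j k * ‖wstar j - wstar k‖ ^ 2
            + ∑ i ∈ Finset.Icc 1 (T - 1), (noiseSeq p n M T σ - noiseSeq p n M i σ)) ∧
      genError μ wstar Ws T
        = 1 / (T : ℝ) *
          (d0Seq p n M T * ∑ i ∈ Finset.Icc 1 T, ‖wstar i‖ ^ 2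
            + ∑ i ∈ Finset.Icc 1 T, ∑ j ∈ Finset.Icc 1 T, ∑ k ∈ Finset.Icc 1 T,
                dSeq p n M i j k T * ‖wstar j - wstar k‖ ^ 2)
          + noiseSeq p n M T σ) := by
  obtain ⟨ξ, hξ, hag⟩ := hdata.exists_columns
  have hdvd : ∀ s, 1 ≤ s → s < T → s ∣ M := fun s h1 h2 => by
    simpa using hM (s + 1) (Finset.mem_Icc.2 ⟨by omega, h2⟩)
  constructor
  · intro hpc
    have hsize : ∀ t < T, ∑ h ∈ range (t + 1), blockSize n M (t + 1) h + 1 < p := by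
      intro t ht
      -- The first time has no memory and fits only n samples; all later times fit n + M.
      rcases Nat.eq_zero_or_pos t with rfl | h0
      · simpa [blockSize] using hp'
      · rw [sum_blockSize_succ (hdvd t h0 ht)]
        exact hpc
    have hmean : ∀ t ∈ Finset.Icc 1 T, ∀ i ∈ Finset.Icc 1 T,
        Integrable (fun ω => modelError wstar i (Wc t ω)) μ ∧
        ∫ ω, modelError wstar i (Wc t ω) ∂μ
          = d0Conc p n M t * ‖wstar i‖ ^ 2
            + ∑ j ∈ Finset.Icc 1 T, ∑ k ∈ Finset.Icc 1 T,
                dConc p n M i j k t * ‖wstar j - wstar k‖ ^ 2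
            + noiseConc p n M t σ := by
      intro t ht i hi
      obtain ⟨ht1, htT⟩ := Finset.mem_Icc.1 ht
      have h := (tracks_concurrent hξ hag wstar hsize htT).hasMean (wstar i)
      rw [concErr_eq hpc wstar (wstar i) ht1 fun s h1 h2 => hdvd s h1 (by omega)] at h
      rw [sum_dConc ht hi, ← add_assoc]
      simp only [modelError, hWc]
      exact h
    exact ⟨hmean, forgetting_eq_and_genError_eq hT hmean⟩
  · have hsize : ∀ t k, t ≤ T → k < t → blockSize n M t k + 1 < p := by
      intro t k _ _
      have := Nat.div_le_self M (t - 1)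
      rw [blockSize]
      -- A memory block has at most M samples, and n ≥ 1 gives M + 1 ≤ n + M < p. This is why the
      -- sequential scheme does not need p > n + M + 1.
      split_ifs <;> omega
    have hmean : ∀ t ∈ Finset.Icc 1 T, ∀ i ∈ Finset.Icc 1 T,
        Integrable (fun ω => modelError wstar i (Ws t ω)) μ ∧
        ∫ ω, modelError wstar i (Ws t ω) ∂μ
          = d0Seq p n M t * ‖wstar i‖ ^ 2
            + ∑ j ∈ Finset.Icc 1 T, ∑ k ∈ Finset.Icc 1 T,
                dSeq p n M i j k t * ‖wstar j - wstar k‖ ^ 2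
            + noiseSeq p n M t σ := by
      intro t ht i hi
      obtain ⟨ht1, htT⟩ := Finset.mem_Icc.1 ht
      have h := (tracks_sequential hξ hag wstar hsize htT).hasMean (wstar i)
      rw [seqErr_eq wstar (wstar i) ht1 fun s h1 h2 => hdvd s h1 (by omega)] at h
      rw [sum_dSeq ht hi]
      simp only [modelError, hWs]
      exact h
    exact ⟨hmean, forgetting_eq_and_genError_eq hT hmean⟩
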